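/- Let $A$ be an irreducible $k\times k$ matrix over $\mathbb{Z}_{\ge 0}$, and let $(X_A,\sigma_A)$ be its edge shift: $X_A$ is the space of bi-infinite paths in the directed graph with $A_{ij}$ edges from $i$ to $j$, and $(\sigma_A x)_i=x_{i+1}$. Assume that $h_{top}(\sigma_A)>0$. Let $\phi$ be an automorphism of $(X_A,\sigma_A)$, i.e. a homeomorphism of $X_A$ commuting with $\sigma_A$. Notation. Let $\lambda_A$ be the Perron--Frobenius eigenvalue (the spectral radius) of $A$. For $x\in X_A$ and $m\in\mathbb{Z}$ let $R(x,m)=\{y\in X_A : y_i=x_i \text{ for all } i\le m\}$ (an $m$-ray). The unstable set of $x$ is $W^u(x)=\bigcup_{n\in\mathbb{Z}}R(x,n)$, with the topology that has the rays $R(y,m)$, $y\in W^u(x)$, $m\in\mathbb{Z}$, as a basis. A canonical family of measures on unstable sets is a family $\mu=\{\mu^x\}_{x\in X_A}$ of Borel measures $\mu^x$ on $W^u(x)$ for which there is a positive right eigenvector $v$ of $A$ for $\lambda_A$ with $\mu^x(R(y,m))=\lambda_A^{-m}\,v(t(y_m))$ for all $x\in X_A$, $y\in W^u(x)$ and $m\in\mathbb{Z}$,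 where $t(e)$ is the terminal state of the edge $e$. An $m$-beam is a finite union of $m$-rays, and a beam is an $m$-beam for some $m$. For an $m$-beam $U$ let $v_{U,m}\in\mathbb{Z}^k$ be the vector whose $J$-th entry is the number of $m$-rays $R(y,m)\subseteq U$ with $t(y_m)=J$. Beams $U,V$ are equivalent if, for some $m$, both are $m$-beams and $v_{U,m}=v_{V,m}$. Let $D_A$ be the group completion of the semigroup of equivalence classes $[U]$ of beams, with $[U]+[V]=[U\cup V]$ for disjoint $U,V$, and let $\phi_*$ be the endomorphism of $D_A$ given by $\phi_*[U]=[\phi(U)]$. The state of a canonical family $\mu$ is a homomorphism $\tau_\mu\colon D_A\to\mathbb{R}$, nonnegative on classes of beams, with $\tau_\mu([R(x,n)])=\mu^x(R(x,n))$ for all $x$ and $n$. Matrices act on row vectors. Let $R(A)=\mathbb{Q}^kA^k$, let $\mathcal{G}_A=\{x\in R(A): xA^n\in\mathbb{Z}^k\text{ for some }n\ge0\}$, let $\mathcal{G}_A^+=\{x\in R(A): xA^n\in\mathbb{Z}_{\ge0}^k\text{ for some }n\ge0\}$, and let $\delta_A(x)=xA$. Let $\theta\colon D_A\to\mathcal{G}_A$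 be the homomorphism with $\theta([U])=\delta_A^{-k-n}(v_{U,n}A^k)$ for every $n$-beam $U$. Then: (i) a canonical family of measures on unstable sets exists, and every canonical family $\mu$ has exactly one state $\tau_\mu$; (ii) there is exactly one automorphism $S_\phi$ of $\mathcal{G}_A$ that maps $\mathcal{G}_A^+$ onto itself, commutes with $\delta_A$, and satisfies $S_\phi\circ\theta=\theta\circ\phi_*$; (iii) $\delta_A\otimes1$ has a nonzero eigenvector in $\mathcal{G}_A\otimes\mathbb{C}$ for the eigenvalue $\lambda_A$; (iv) there is a real number $\lambda_\phi>0$ such that - $\lambda_\phi$ is the unique real number $c$ for which $\mu^{\phi(x)}(\phi(S))=c\,\mu^x(S)$ for every canonical family $\mu$, every $x\in X_A$ and every Borel set $S\subseteq W^u(x)$; - $\lambda_\phi$ is the unique real number $c$ for which $\tau_\mu(\phi_*(d))=c\,\tau_\mu(d)$ for every canonical family $\mu$ and every $d\in D_A$; - $\lambda_\phi$ is the unique complex number $c$ for which $(S_\phi\otimes1)v=c\,v$ for every $v\in\mathcal{G}_A\otimes\mathbb{C}$ with $(\delta_A\otimes1)v=\lambda_A v$; - $\log\lambda_\phi\le h_{top}(\phi)$,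 and moreover $|\log\lambda_\phi|\le h_{top}(\phi)$. -/

import Mathlib

open Set Filter Topology MeasureTheory
open scoped Matrix TensorProduct

noncomputable section

namespace SFT

/-! ### Edge shifts -/

/-- The edges of the directed graph with vertex set `Fin k` that has `A i j` edges from `i`
to `j`. -/
structure Edge {k : ℕ} (A : Matrix (Fin k) (Fin k) ℕ) where
  /-- the initial state -/
  src : Fin k
  /-- the terminal state -/
  tgt : Fin k
  /-- the number of the edge among those from `src` to `tgt` -/
  idx : Fin (A src tgt)

/-- The alphabet carries the discrete uniformity. -/
instance {k : ℕ} (A : Matrix (Fin k) (Fin k) ℕ) : UniformSpace (Edge A) := ⊥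

instance {k : ℕ} (A : Matrix (Fin k) (Fin k) ℕ) : DiscreteUniformity (Edge A) := ⟨rfl⟩

instance {k : ℕ} (A : Matrix (Fin k) (Fin k) ℕ) : Finite (Edge A) :=
  Finite.of_injective
    (fun e : Edge A => (⟨(e.src, e.tgt), e.idx⟩ : Σ p : Fin k × Fin k, Fin (A p.1 p.2)))
    (by
      rintro ⟨a, b, c⟩ ⟨a', b', c'⟩ h
      simp only [Sigma.mk.injEq, Prod.mk.injEq] at h
      obtain ⟨⟨rfl, rfl⟩, h⟩ := h
      simpa using h)

/-- The edge shift `X_A`: bi-infinite paths in the graph of `A`, with the uniformity (and the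
topology) of pointwise convergence. -/
abbrev Shift {k : ℕ} (A : Matrix (Fin k) (Fin k) ℕ) : Type :=
  {x : ℤ → Edge A // ∀ i, (x i).tgt = (x (i + 1)).src}

instance {k : ℕ} (A : Matrix (Fin k) (Fin k) ℕ) : CoeFun (Shift A) (fun _ => ℤ → Edge A) :=
  ⟨Subtype.val⟩

section

variable {k : ℕ} {A : Matrix (Fin k) (Fin k) ℕ}

theorem Shift.ext {x y : Shift A} (h : ∀ i, x i = y i) : x = y :=
  Subtype.ext (funext h)

theorem Shift.adj (x : Shift A) (i : ℤ) : (x i).tgt = (x (i + 1)).src := x.2 i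

theorem Shift.continuous_apply (i : ℤ) : Continuous (fun x : Shift A => x i) :=
  (_root_.continuous_apply i).comp continuous_subtype_val

instance : CompactSpace (Shift A) := by
  have hc : IsClosed {x : ℤ → Edge A | ∀ i, (x i).tgt = (x (i + 1)).src} := by
    rw [ofPred_forall]
    refine isClosed_iInter fun i => ?_
    have h : Continuous (fun x : ℤ → Edge A => (x i, x (i + 1))) := by fun_prop
    exact (isClosed_discrete {p : Edge A × Edge A | p.1.tgt = p.2.src}).preimage h
  exact isCompact_iff_compactSpace.mp hc.isCompact

end

/-- The shift map `σ_A`, `(σ_A x)_i = x_{i+1}`. -/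
def shift {k : ℕ} (A : Matrix (Fin k) (Fin k) ℕ) : Shift A ≃ₜ Shift A where
  toFun x := ⟨fun i => x (i + 1), fun i => x.adj (i + 1)⟩
  invFun x := ⟨fun i => x (i - 1), fun i => by
    have h := x.adj (i - 1)
    rwa [show i - 1 + 1 = i + 1 - 1 by ring] at h⟩
  left_inv x := Shift.ext fun i => by
    change x (i - 1 + 1) = x i
    rw [sub_add_cancel]
  right_inv x := Shift.ext fun i => by
    change x (i + 1 - 1) = x i
    rw [add_sub_cancel_right]
  continuous_toFun := Continuous.subtype_mk
    (continuous_pi fun i => Shift.continuous_apply (i + 1)) _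
  continuous_invFun := Continuous.subtype_mk
    (continuous_pi fun i => Shift.continuous_apply (i - 1)) _

/-- Automorphisms of `(X_A, σ_A)`: self-homeomorphisms commuting with the shift. -/
abbrev Aut {k : ℕ} (A : Matrix (Fin k) (Fin k) ℕ) : Type :=
  {φ : Shift A ≃ₜ Shift A // ∀ x, φ (shift A x) = shift A (φ x)}

instance {k : ℕ} (A : Matrix (Fin k) (Fin k) ℕ) :
    CoeFun (Aut A) (fun _ => Shift A → Shift A) :=
  ⟨fun φ => φ.1⟩

/-- Topological entropy of a self-map of the compact space `X_A`. -/
def htop {k : ℕ} {A : Matrix (Fin k) (Fin k) ℕ} (f : Shift A → Shift A) : EReal :=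
  Dynamics.coverEntropy f univ

/-- Irreducibility of a matrix over the nonnegative integers. -/
def Irred {k : ℕ} (A : Matrix (Fin k) (Fin k) ℕ) : Prop :=
  (A.map (Nat.cast : ℕ → ℝ)).IsIrreducible

/-! ### Rays and beams -/

section

variable {k : ℕ} {A : Matrix (Fin k) (Fin k) ℕ}

/-- The `m`-ray `R(x, m)`: the points that agree with `x` on `(-∞, m]`. -/
def ray (x : Shift A) (m : ℤ) : Set (Shift A) := {y | ∀ i ≤ m, y i = x i}

/-- An `m`-beam is a finite union of `m`-rays. -/
def IsBeamAt (m : ℤ) (U : Set (Shift A)) : Prop :=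
  ∃ s : Set (Shift A), s.Finite ∧ U = ⋃ x ∈ s, ray x m

/-- A beam is an `m`-beam for some `m`. -/
def IsBeam (U : Set (Shift A)) : Prop := ∃ m, IsBeamAt m U

/-- The `m`-rays `R(y, m)` with `y ∈ U` whose last edge `y_m` ends at the state `J`. -/
def raysEndingAt (U : Set (Shift A)) (m : ℤ) (J : Fin k) : Set (Set (Shift A)) :=
  (fun y => ray y m) '' {y ∈ U | (y m).tgt = J}

/-- The vector `v_{U,m}` of an `m`-beam `U`: its `J`-th entry is the number of the `m`-rays
that make up `U` and end at the state `J`. -/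
def beamVec (U : Set (Shift A)) (m : ℤ) (J : Fin k) : ℕ := (raysEndingAt U m J).ncard

/-- Equivalence of beams: `v_{U,m} = v_{V,m}` for some `m` for which both are `m`-beams. -/
def BeamEquiv (U V : Set (Shift A)) : Prop :=
  ∃ m, IsBeamAt m U ∧ IsBeamAt m V ∧ ∀ J, beamVec U m J = beamVec V m J

theorem self_mem_ray (x : Shift A) (m : ℤ) : x ∈ ray x m := fun _ _ => rfl

theorem ray_eq_iff {x y : Shift A} {m : ℤ} : ray x m = ray y m ↔ ∀ i ≤ m, x i = y i := by
  constructor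
  · intro h
    have : x ∈ ray y m := h ▸ self_mem_ray x m
    exact this
  · intro h
    ext z
    exact forall₂_congr fun i hi => by rw [h i hi]

theorem ray_eq_of_mem {x y : Shift A} {m : ℤ} (h : y ∈ ray x m) : ray y m = ray x m :=
  ray_eq_iff.2 h

theorem isBeamAt_iff {m : ℤ} {U : Set (Shift A)} :
    IsBeamAt m U ↔ (∀ y ∈ U, ray y m ⊆ U) ∧ ((fun y => ray y m) '' U).Finite := by
  constructor
  · rintro ⟨s, hs, rfl⟩
    refine ⟨fun y hy => ?_, ?_⟩
    · simp only [mem_iUnion] at hy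
      obtain ⟨x, hx, hy⟩ := hy
      rw [ray_eq_of_mem hy]
      exact subset_biUnion_of_mem (u := fun x => ray x m) hx
    · refine (hs.image fun y => ray y m).subset ?_
      rintro _ ⟨y, hy, rfl⟩
      simp only [mem_iUnion] at hy
      obtain ⟨x, hx, hy⟩ := hy
      exact ⟨x, hx, (ray_eq_of_mem hy).symm⟩
  · rintro ⟨h1, h2⟩
    obtain ⟨s, hsU, hs, hs'⟩ := exists_subset_image_finite_and.1 ⟨_, Subset.rfl, h2, rfl⟩
    refine ⟨s, hs, Subset.antisymm (fun y hy => ?_) (iUnion₂_subset fun x hx => h1 x (hsU hx))⟩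
    have : ray y m ∈ (fun y => ray y m) '' s := hs' ▸ mem_image_of_mem _ hy
    obtain ⟨x, hx, hxy⟩ := this
    refine mem_biUnion hx ?_
    exact ray_eq_iff.1 hxy.symm

theorem isBeam_ray (x : Shift A) (m : ℤ) : IsBeam (ray x m) :=
  ⟨m, {x}, finite_singleton x, by simp⟩

theorem IsBeamAt.mono {m n : ℤ} (h : m ≤ n) {U : Set (Shift A)} (hU : IsBeamAt m U) :
    IsBeamAt n U := by
  rw [isBeamAt_iff] at hU ⊢
  refine ⟨fun y hy => fun z hz => hU.1 y hy fun i hi => hz i (hi.trans h), ?_⟩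
  have hf : (range fun y : Shift A => fun i : Icc m n => y i).Finite := toFinite _
  refine ((hU.2.prod hf).image
    (fun p => {z : Shift A | z ∈ p.1 ∧ (fun i : Icc m n => z i) = p.2})).subset ?_
  rintro _ ⟨y, hy, rfl⟩
  refine ⟨(ray y m, fun i => y i), ⟨mem_image_of_mem _ hy, mem_range_self y⟩, ?_⟩
  ext z
  constructor
  · rintro ⟨h1, h2⟩ i hi
    rcases le_total i m with h' | h'
    · exact h1 i h'
    · exact congr_fun h2 ⟨i, h', hi⟩
  · exact fun hz => ⟨fun i hi => hz i (hi.trans h), funext fun i => hz i i.2.2⟩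

theorem IsBeamAt.union {m : ℤ} {U V : Set (Shift A)} (hU : IsBeamAt m U) (hV : IsBeamAt m V) :
    IsBeamAt m (U ∪ V) := by
  obtain ⟨s, hs, rfl⟩ := hU
  obtain ⟨t, ht, rfl⟩ := hV
  exact ⟨s ∪ t, hs.union ht, (biUnion_union _ _ _).symm⟩

theorem IsBeam.union {U V : Set (Shift A)} (hU : IsBeam U) (hV : IsBeam V) : IsBeam (U ∪ V) := by
  obtain ⟨m, hm⟩ := hU
  obtain ⟨n, hn⟩ := hV
  exact ⟨max m n, (hm.mono (le_max_left _ _)).union (hn.mono (le_max_right _ _))⟩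

theorem finite_raysEndingAt {m : ℤ} {U : Set (Shift A)} (hU : IsBeamAt m U) (J : Fin k) :
    (raysEndingAt U m J).Finite :=
  (isBeamAt_iff.1 hU).2.subset (image_mono (sep_subset _ _))

theorem beamVec_union {m : ℤ} {U V : Set (Shift A)} (hU : IsBeamAt m U) (hV : IsBeamAt m V)
    (hd : Disjoint U V) (J : Fin k) : beamVec (U ∪ V) m J = beamVec U m J + beamVec V m J := by
  unfold beamVec
  rw [← ncard_union_eq ?_ (finite_raysEndingAt hU J) (finite_raysEndingAt hV J)]
  · congr 1
    simp only [raysEndingAt, ← image_union]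
    congr 1
    ext y
    simp only [mem_ofPred_eq, mem_union]
    tauto
  · rw [Set.disjoint_left]
    rintro _ ⟨y, hy, rfl⟩ ⟨z, hz, hzy⟩
    have h : z ∈ ray y m := ray_eq_iff.1 hzy
    exact Set.disjoint_left.1 hd ((isBeamAt_iff.1 hU).1 y hy.1 h) hz.1

/-! ### Automorphisms act on rays and beams -/

/-- `φ` has coding range `r`. -/
def HasRange (φ : Shift A → Shift A) (r : ℕ) : Prop :=
  ∀ (x y : Shift A) (i : ℤ), (∀ j, i - r ≤ j → j ≤ i + r → x j = y j) → φ x i = φ y i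

theorem HasRange.mono {φ : Shift A → Shift A} {r s : ℕ} (h : HasRange φ r) (hrs : r ≤ s) :
    HasRange φ s :=
  fun x y i hxy => h x y i fun j h1 h2 => hxy j (by omega) (by omega)

theorem exists_range (φ : Shift A → Shift A) (hc : Continuous φ)
    (h : ∀ x, φ (shift A x) = shift A (φ x)) : ∃ r, HasRange φ r := by
  have hu : UniformContinuous (fun x : Shift A => φ x 0) :=
    CompactSpace.uniformContinuous_of_continuous ((Shift.continuous_apply 0).comp hc)
  have hmem : {p : Shift A × Shift A | φ p.1 0 = φ p.2 0} ∈ uniformity (Shift A) := by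
    have h1 : (SetRel.id : SetRel (Edge A) (Edge A)) ∈ uniformity (Edge A) := by
      rw [DiscreteUniformity.eq_principal_setRelId]
      exact mem_principal_self _
    exact hu h1
  obtain ⟨r, hr⟩ : ∃ r : ℕ, ∀ x y : Shift A,
      (∀ j : ℤ, -r ≤ j → j ≤ r → x j = y j) → φ x 0 = φ y 0 := by
    rw [uniformity_subtype, Pi.uniformity, comap_iInf] at hmem
    simp only [DiscreteUniformity.eq_principal_setRelId, comap_principal] at hmem
    rw [(hasBasis_iInf_principal_finite _).mem_iff] at hmem
    obtain ⟨t, ht, hsub⟩ := hmem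
    obtain ⟨r, hr⟩ : ∃ r : ℕ, ∀ j ∈ t, j.natAbs ≤ r := by
      obtain ⟨r, hr⟩ := (ht.image Int.natAbs).bddAbove
      exact ⟨r, fun j hj => hr (mem_image_of_mem _ hj)⟩
    refine ⟨r, fun x y hxy => ?_⟩
    refine hsub (show (x, y) ∈ _ from ?_)
    simp only [mem_iInter]
    intro j hj
    have := hr j hj
    exact hxy j (by omega) (by omega)
  have hz : ∀ (n : ℕ) (x y : Shift A) (i : ℤ), i.natAbs = n →
      (∀ j, i - r ≤ j → j ≤ i + r → x j = y j) → φ x i = φ y i := by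
    have h' : ∀ x, φ ((shift A).symm x) = (shift A).symm (φ x) := fun x => by
      rw [Homeomorph.eq_symm_apply, ← h, Homeomorph.apply_symm_apply]
    intro n
    induction n with
    | zero =>
      intro x y i hi hxy
      obtain rfl : i = 0 := by omega
      exact hr x y fun j h1 h2 => hxy j (by omega) (by omega)
    | succ n ih =>
      intro x y i hi hxy
      rcases lt_or_ge i 0 with h0 | h0
      · have := ih ((shift A).symm x) ((shift A).symm y) (i + 1) (by omega)
          (fun j h1 h2 => hxy (j - 1) (by omega) (by omega))
        rw [h', h'] at this
        change φ x (i + 1 - 1) = φ y (i + 1 - 1) at this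
        rwa [add_sub_cancel_right] at this
      · have := ih (shift A x) (shift A y) (i - 1) (by omega)
          (fun j h1 h2 => hxy (j + 1) (by omega) (by omega))
        rw [h, h] at this
        change φ x (i - 1 + 1) = φ y (i - 1 + 1) at this
        rwa [sub_add_cancel] at this
  exact ⟨r, fun x y i hxy => hz _ x y i rfl hxy⟩

theorem Aut.exists_range (φ : Aut A) : ∃ r, HasRange φ r ∧ HasRange φ.1.symm r := by
  obtain ⟨r, hr⟩ := SFT.exists_range φ φ.1.continuous φ.2
  obtain ⟨s, hs⟩ := SFT.exists_range φ.1.symm φ.1.symm.continuous fun x => by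
    rw [Homeomorph.symm_apply_eq, φ.2, Homeomorph.apply_symm_apply]
  exact ⟨max r s, hr.mono (le_max_left _ _), hs.mono (le_max_right _ _)⟩

theorem HasRange.agree {φ : Shift A → Shift A} {r : ℕ} (h : HasRange φ r) {x y : Shift A} {m : ℤ}
    (hxy : ∀ i ≤ m, x i = y i) : ∀ i ≤ m - r, φ x i = φ y i :=
  fun i hi => h x y i fun j _ hj => hxy j (by omega)

theorem HasRange.agree_symm {φ : Aut A} {r : ℕ} (h : HasRange φ.1.symm r) {x y : Shift A} {m : ℤ}
    (hxy : ∀ i ≤ m, φ x i = φ y i) : ∀ i ≤ m - r, x i = y i := by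
  have := h.agree hxy
  change ∀ i ≤ m - r, φ.1.symm (φ.1 x) i = φ.1.symm (φ.1 y) i at this
  simpa using this

theorem IsBeamAt.image {φ : Aut A} {r : ℕ} (h : HasRange φ r) (h' : HasRange φ.1.symm r)
    {m n : ℤ} (hn : m + r ≤ n) {U : Set (Shift A)} (hU : IsBeamAt m U) :
    IsBeamAt n (φ '' U) := by
  have hU' := isBeamAt_iff.1 (hU.mono (show m ≤ n + r by omega))
  rw [isBeamAt_iff]
  refine ⟨?_, ?_⟩
  · rintro _ ⟨y, hy, rfl⟩ z hz
    refine ⟨φ.1.symm z, (isBeamAt_iff.1 hU).1 y hy ?_, φ.1.apply_symm_apply z⟩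
    intro i hi
    refine h'.agree_symm (m := n) (fun j hj => ?_) i (by omega)
    rw [← hz j hj]
    exact congr_arg (fun w : Shift A => w j) (φ.1.apply_symm_apply z)
  · refine (hU'.2.image fun R => {z | ∃ y ∈ R, z ∈ ray (φ y) n}).subset ?_
    rintro _ ⟨_, ⟨y, hy, rfl⟩, rfl⟩
    refine ⟨_, mem_image_of_mem _ hy, ?_⟩
    ext z
    constructor
    · rintro ⟨w, hw, hz⟩ i hi
      rw [hz i hi]
      exact h.agree hw i (by omega)
    · exact fun hz => ⟨y, self_mem_ray _ _, hz⟩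

theorem IsBeam.image (φ : Aut A) {U : Set (Shift A)} (hU : IsBeam U) : IsBeam (φ '' U) := by
  obtain ⟨r, h, h'⟩ := φ.exists_range
  obtain ⟨m, hm⟩ := hU
  exact ⟨m + r, hm.image h h' le_rfl⟩

theorem ncard_image_congr {α β γ : Type*} {P : Set α} (a : α → β) (b : α → γ)
    (h : ∀ y ∈ P, ∀ z ∈ P, a y = a z ↔ b y = b z) : (a '' P).ncard = (b '' P).ncard := by
  classical
  have ha : ∀ c ∈ a '' P, ∃ y ∈ P, a y = c := fun c hc => hc
  choose g hgP hg using ha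
  refine ncard_congr (fun c hc => b (g c hc)) (fun c hc => mem_image_of_mem _ (hgP c hc)) ?_ ?_
  · intro c d hc hd hcd
    rw [← hg c hc, ← hg d hd]
    exact (h _ (hgP c hc) _ (hgP d hd)).2 hcd
  · rintro _ ⟨y, hy, rfl⟩
    have hm := mem_image_of_mem a hy
    exact ⟨a y, hm, (h _ (hgP _ hm) _ hy).1 (hg _ hm)⟩

/-- The point that follows `x` up to time `m` and `y` from then on. -/
def splice (x y : Shift A) (m : ℤ) (h : (x m).tgt = (y (m + 1)).src) : Shift A :=
  ⟨fun i => if i ≤ m then x i else y i, fun i => by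
    beta_reduce
    rcases lt_trichotomy i m with hi | rfl | hi
    · rw [if_pos hi.le, if_pos (by omega)]
      exact x.adj i
    · rw [if_pos le_rfl, if_neg (by omega)]
      exact h
    · rw [if_neg (by omega), if_neg (by omega)]
      exact y.adj i⟩

theorem splice_of_le {x y : Shift A} {m : ℤ} (h : (x m).tgt = (y (m + 1)).src) {i : ℤ}
    (hi : i ≤ m) : splice x y m h i = x i := if_pos hi

theorem splice_of_lt {x y : Shift A} {m : ℤ} (h : (x m).tgt = (y (m + 1)).src) {i : ℤ}
    (hi : m < i) : splice x y m h i = y i := if_neg (by omega)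

theorem beamVec_image_ray {φ : Aut A} {r : ℕ} (h : HasRange φ r) (h' : HasRange φ.1.symm r)
    {m N : ℤ} (hN : m + 3 * r < N) {x x' : Shift A} (hx : (x m).tgt = (x' m).tgt) (J : Fin k) :
    beamVec (φ '' ray x m) N J = beamVec (φ '' ray x' m) N J := by
  classical
  have hs : ∀ y ∈ ray x m, (x' m).tgt = (y (m + 1)).src := fun y hy => by
    rw [← hx, ← y.adj, hy m le_rfl]
  let f : Shift A → Shift A := fun y =>
    if hy : (x' m).tgt = (y (m + 1)).src then splice x' y m hy else y
  have hle : ∀ y ∈ ray x m, ∀ i ≤ m, f y i = x' i := fun y hy i hi => by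
    simp only [f, dif_pos (hs y hy)]
    exact splice_of_le _ hi
  have hlt : ∀ y ∈ ray x m, ∀ i, m < i → f y i = y i := fun y hy i hi => by
    simp only [f, dif_pos (hs y hy)]
    exact splice_of_lt _ hi
  have hfar : ∀ y ∈ ray x m, ∀ i, m + r < i → φ (f y) i = φ y i := fun y hy i hi =>
    h _ _ i fun j hj _ => hlt y hy j (by omega)
  let P : Set (Shift A) := {y ∈ ray x m | (φ y N).tgt = J}
  have e1 : raysEndingAt (φ '' ray x m) N J = (fun y => ray (φ y) N) '' P := by
    ext R
    constructor
    · rintro ⟨_, ⟨⟨y, hy, rfl⟩, hJ⟩, rfl⟩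
      exact ⟨y, ⟨hy, hJ⟩, rfl⟩
    · rintro ⟨y, ⟨hy, hJ⟩, rfl⟩
      exact ⟨φ y, ⟨⟨y, hy, rfl⟩, hJ⟩, rfl⟩
  have e2 : raysEndingAt (φ '' ray x' m) N J = (fun y => ray (φ (f y)) N) '' P := by
    ext R
    constructor
    · rintro ⟨_, ⟨⟨z, hz, rfl⟩, hJ⟩, rfl⟩
      have hxz : (x m).tgt = (z (m + 1)).src := by rw [hx, ← z.adj, hz m le_rfl]
      let y := splice x z m hxz
      have hy : y ∈ ray x m := fun i hi => splice_of_le hxz hi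
      have hyz : f y = z := Shift.ext fun i => by
        rcases le_or_gt i m with hi | hi
        · rw [hle y hy i hi, hz i hi]
        · rw [hlt y hy i hi]
          exact splice_of_lt hxz hi
      refine ⟨y, ⟨hy, ?_⟩, ?_⟩
      · rw [← hfar y hy N (by omega), hyz]
        exact hJ
      · simp only [hyz]
    · rintro ⟨y, ⟨hy, hJ⟩, rfl⟩
      refine ⟨φ (f y), ⟨⟨f y, fun i hi => hle y hy i hi, rfl⟩, ?_⟩, rfl⟩
      rw [hfar y hy N (by omega)]
      exact hJ
  unfold beamVec
  rw [e1, e2]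
  refine ncard_image_congr _ _ fun y hy z hz => ?_
  replace hy := hy.1
  replace hz := hz.1
  simp only [ray_eq_iff]
  constructor
  · intro hyz i hi
    rcases le_or_gt i (m + r) with hi' | hi'
    · have hyz' := h'.agree_symm hyz
      refine h _ _ i fun j _ hj => ?_
      rcases le_or_gt j m with hjm | hjm
      · rw [hle y hy j hjm, hle z hz j hjm]
      · rw [hlt y hy j hjm, hlt z hz j hjm]
        exact hyz' j (by omega)
    · rw [hfar y hy i hi', hfar z hz i hi']
      exact hyz i hi
  · intro hyz i hi
    rcases le_or_gt i (m + r) with hi' | hi'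
    · have hyz' := h'.agree_symm hyz
      refine h _ _ i fun j _ hj => ?_
      rcases le_or_gt j m with hjm | hjm
      · rw [hy j hjm, hz j hjm]
      · rw [← hlt y hy j hjm, ← hlt z hz j hjm]
        exact hyz' j (by omega)
    · rw [← hfar y hy i hi', ← hfar z hz i hi']
      exact hyz i hi

theorem beamVec_image_eq_sum {φ : Aut A} {m N : ℤ} {U : Set (Shift A)} (hU : IsBeamAt m U)
    (hV : IsBeamAt N (φ '' U))
    (hN : ∀ y z : Shift A, (∀ i ≤ N, φ y i = φ z i) → ∀ i ≤ m, y i = z i)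
    (c : Fin k → Fin k → ℕ)
    (hc : ∀ x ∈ U, ∀ J, beamVec (φ '' ray x m) N J = c (x m).tgt J) (J : Fin k) :
    beamVec (φ '' U) N J = ∑ I, beamVec U m I * c I J := by
  classical
  let T := (finite_raysEndingAt hV J).toFinset
  let S := fun I => (finite_raysEndingAt hU I).toFinset
  let f : Set (Shift A) → Set (Shift A) := fun R => {w | ∃ y, φ y ∈ R ∧ w ∈ ray y m}
  have hf : ∀ y, f (ray (φ y) N) = ray y m := fun y => by
    ext w
    constructor
    · rintro ⟨z, hz, hw⟩
      rw [← ray_eq_of_mem (show z ∈ ray y m from hN z y hz)]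
      exact hw
    · exact fun hw => ⟨y, self_mem_ray _ _, hw⟩
  have hmaps : ∀ R ∈ T, f R ∈ Finset.univ.biUnion S := by
    intro R hR
    simp only [T, Finite.mem_toFinset] at hR
    obtain ⟨_, ⟨⟨y, hy, rfl⟩, hJ⟩, rfl⟩ := hR
    simp only [Finset.mem_biUnion, Finset.mem_univ, true_and, S, Finite.mem_toFinset]
    refine ⟨(y m).tgt, y, ⟨hy, rfl⟩, ?_⟩
    exact (hf y).symm
  have hdisj : (↑(Finset.univ : Finset (Fin k)) : Set (Fin k)).PairwiseDisjoint S := by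
    intro I _ I' _ hne
    refine Finset.disjoint_left.2 fun R h1 h2 => hne ?_
    simp only [S, Finite.mem_toFinset] at h1 h2
    obtain ⟨y, ⟨_, hy⟩, rfl⟩ := h1
    obtain ⟨z, ⟨_, hz⟩, hzy⟩ := h2
    rw [← hy, ← hz, ray_eq_iff.1 hzy m le_rfl]
  have hfib : ∀ I, ∀ R ∈ S I, (T.filter fun Q => f Q = R).card = c I J := by
    intro I R hR
    simp only [S, Finite.mem_toFinset] at hR
    obtain ⟨x, ⟨hx, rfl⟩, rfl⟩ := hR
    rw [← hc x hx J, beamVec, ← ncard_coe_finset]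
    congr 1
    ext Q
    simp only [Finset.coe_filter, T, Finite.mem_toFinset, mem_ofPred_eq]
    constructor
    · rintro ⟨⟨_, ⟨⟨y, hy, rfl⟩, hJ⟩, rfl⟩, hQ⟩
      replace hQ : f (ray (φ y) N) = ray x m := hQ
      rw [hf] at hQ
      exact ⟨φ y, ⟨⟨y, ray_eq_iff.1 hQ, rfl⟩, hJ⟩, rfl⟩
    · rintro ⟨_, ⟨⟨y, hy, rfl⟩, hJ⟩, rfl⟩
      refine ⟨⟨φ y, ⟨⟨y, (isBeamAt_iff.1 hU).1 x hx hy, rfl⟩, hJ⟩, rfl⟩, ?_⟩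
      exact (hf y).trans (ray_eq_of_mem hy)
  have hT : beamVec (φ '' U) N J = T.card := by
    rw [beamVec, ncard_eq_toFinset_card _ (finite_raysEndingAt hV J)]
  rw [hT, Finset.card_eq_sum_card_fiberwise hmaps, Finset.sum_biUnion hdisj]
  refine Finset.sum_congr rfl fun I _ => ?_
  rw [Finset.sum_congr rfl (hfib I), Finset.sum_const, smul_eq_mul, beamVec,
    ncard_eq_toFinset_card _ (finite_raysEndingAt hU I)]

theorem BeamEquiv.image (φ : Aut A) {U V : Set (Shift A)} (h : BeamEquiv U V) :
    BeamEquiv (φ '' U) (φ '' V) := by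
  classical
  obtain ⟨m, hU, hV, hv⟩ := h
  obtain ⟨r, hr, hr'⟩ := φ.exists_range
  let N : ℤ := m + 3 * r + 1
  have hUN := hU.image hr hr' (show m + r ≤ N by omega)
  have hVN := hV.image hr hr' (show m + r ≤ N by omega)
  have hN : ∀ y z : Shift A, (∀ i ≤ N, φ y i = φ z i) → ∀ i ≤ m, y i = z i :=
    fun y z h i hi => hr'.agree_symm h i (by omega)
  let c : Fin k → Fin k → ℕ := fun I J =>
    if hI : ∃ x : Shift A, (x m).tgt = I then beamVec (φ '' ray hI.choose m) N J else 0
  have hc : ∀ x J, beamVec (φ '' ray x m) N J = c (x m).tgt J := fun x J => by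
    have hI : ∃ y : Shift A, (y m).tgt = (x m).tgt := ⟨x, rfl⟩
    simp only [c, dif_pos hI]
    exact beamVec_image_ray hr hr' (by omega) hI.choose_spec.symm J
  refine ⟨N, hUN, hVN, fun J => ?_⟩
  rw [beamVec_image_eq_sum hU hUN hN c (fun x _ => hc x),
    beamVec_image_eq_sum hV hVN hN c (fun x _ => hc x)]
  simp only [hv]

end

/-! ### The dimension group of beams -/

/-- The beams of `X_A`. -/
abbrev Beam {k : ℕ} (A : Matrix (Fin k) (Fin k) ℕ) : Type := {U : Set (Shift A) // IsBeam U}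

/-- The defining relations of `D_A`: equivalent beams have the same class, and the class of a
disjoint union is the sum of the classes. -/
def dimRels {k : ℕ} (A : Matrix (Fin k) (Fin k) ℕ) : Set (FreeAbelianGroup (Beam A)) :=
  {g | ∃ U V : Beam A, BeamEquiv U.1 V.1 ∧ g = FreeAbelianGroup.of U - FreeAbelianGroup.of V} ∪
  {g | ∃ U V W : Beam A, Disjoint U.1 V.1 ∧ W.1 = U.1 ∪ V.1 ∧
    g = FreeAbelianGroup.of W - (FreeAbelianGroup.of U + FreeAbelianGroup.of V)}

/-- Krieger's dimension group `D_A`: the group completion of the semigroup of equivalence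
classes of beams with `[U] + [V] = [U' ∪ V']` for disjoint `U' ∼ U`, `V' ∼ V`. The group
completion is given by its presentation: generators `[U]`, and the relations `dimRels`. -/
abbrev DimGroup {k : ℕ} (A : Matrix (Fin k) (Fin k) ℕ) : Type :=
  FreeAbelianGroup (Beam A) ⧸ AddSubgroup.closure (dimRels A)

section

variable {k : ℕ} {A : Matrix (Fin k) (Fin k) ℕ}

/-- The class `[U]` of a beam in `D_A`. -/
def beamClass (U : Beam A) : DimGroup A := QuotientAddGroup.mk (FreeAbelianGroup.of U)

/-- A function on beams that respects the relations induces a homomorphism on `D_A`. -/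
def dimLift {G : Type*} [AddCommGroup G] (f : Beam A → G)
    (h1 : ∀ U V : Beam A, BeamEquiv U.1 V.1 → f U = f V)
    (h2 : ∀ U V W : Beam A, Disjoint U.1 V.1 → W.1 = U.1 ∪ V.1 → f W = f U + f V) :
    DimGroup A →+ G :=
  QuotientAddGroup.lift _ (FreeAbelianGroup.lift f) <| by
    rw [AddSubgroup.closure_le]
    rintro g (⟨U, V, h, rfl⟩ | ⟨U, V, W, hd, hW, rfl⟩)
    · simp [h1 U V h]
    · simp [h2 U V W hd hW]

@[simp]
theorem dimLift_beamClass {G : Type*} [AddCommGroup G] (f : Beam A → G)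
    (h1 : ∀ U V : Beam A, BeamEquiv U.1 V.1 → f U = f V)
    (h2 : ∀ U V W : Beam A, Disjoint U.1 V.1 → W.1 = U.1 ∪ V.1 → f W = f U + f V)
    (U : Beam A) : dimLift f h1 h2 (beamClass U) = f U := by
  simp [dimLift, beamClass]

theorem beamClass_eq {U V : Beam A} (h : BeamEquiv U.1 V.1) : beamClass U = beamClass V := by
  unfold beamClass
  rw [← sub_eq_zero, ← QuotientAddGroup.mk_sub, QuotientAddGroup.eq_zero_iff]
  exact AddSubgroup.subset_closure (Or.inl ⟨U, V, h, rfl⟩)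

theorem beamClass_union {U V W : Beam A} (hd : Disjoint U.1 V.1) (hW : W.1 = U.1 ∪ V.1) :
    beamClass W = beamClass U + beamClass V := by
  unfold beamClass
  rw [← sub_eq_zero, ← QuotientAddGroup.mk_add, ← QuotientAddGroup.mk_sub,
    QuotientAddGroup.eq_zero_iff]
  exact AddSubgroup.subset_closure (Or.inr ⟨U, V, W, hd, hW, rfl⟩)

/-- The image of a beam under an automorphism. -/
def Aut.mapBeam (φ : Aut A) (U : Beam A) : Beam A := ⟨φ '' U.1, U.2.image φ⟩

/-- The endomorphism `φ_*` of `D_A` with `φ_* [U] = [φ(U)]`. -/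
def Aut.dimMap (φ : Aut A) : DimGroup A →+ DimGroup A :=
  dimLift (fun U => beamClass (φ.mapBeam U))
    (fun _ _ h => beamClass_eq (h.image φ))
    (fun U V W hd hW => beamClass_union
      ((disjoint_image_iff φ.1.injective).2 hd)
      (by change φ '' W.1 = φ '' U.1 ∪ φ '' V.1; rw [hW, image_union]))

/-- A ray, as a beam. -/
def rayBeam (x : Shift A) (m : ℤ) : Beam A := ⟨ray x m, isBeam_ray x m⟩

end

/-! ### The dimension triple of the matrix -/

/-- `A` as a matrix over `ℚ`. -/
abbrev ratMat {k : ℕ} (A : Matrix (Fin k) (Fin k) ℕ) : Matrix (Fin k) (Fin k) ℚ :=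
  A.map (Nat.cast : ℕ → ℚ)

/-- The eventual range `R(A) = ℚ^k A^k` (row vectors). -/
def eventualRange {k : ℕ} (A : Matrix (Fin k) (Fin k) ℕ) : Submodule ℚ (Fin k → ℚ) :=
  LinearMap.range (ratMat A ^ k).vecMulLinear

section

variable {k : ℕ} {A : Matrix (Fin k) (Fin k) ℕ}

theorem int_vecMul (w : Fin k → ℤ) (n : ℕ) :
    (fun i => (w i : ℚ)) ᵥ* ratMat A ^ n =
      fun i => (((w ᵥ* (A.map (Nat.cast : ℕ → ℤ)) ^ n) i : ℤ) : ℚ) := by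
  have h : ratMat A = (A.map (Nat.cast : ℕ → ℤ)).map (Int.castRingHom ℚ) := by
    ext i j
    simp
  rw [h, ← Matrix.map_pow]
  ext i
  simp [Matrix.vecMul, dotProduct]

theorem vecMul_mem_eventualRange {x : Fin k → ℚ} (hx : x ∈ eventualRange A) :
    x ᵥ* ratMat A ∈ eventualRange A := by
  obtain ⟨y, rfl⟩ := hx
  refine ⟨y ᵥ* ratMat A, ?_⟩
  simp only [Matrix.vecMulLinear_apply, Matrix.vecMul_vecMul]
  rw [← pow_succ, ← pow_succ']

theorem eq_zero_of_vecMul_eq_zero {x : Fin k → ℚ} (hx : x ∈ eventualRange A)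
    (h : x ᵥ* ratMat A = 0) : x = 0 := by
  obtain ⟨y, rfl⟩ := hx
  let f : Module.End ℚ (Fin k → ℚ) := (ratMat A).vecMulLinear
  have hf : ∀ n, f ^ n = (ratMat A ^ n).vecMulLinear := by
    intro n
    induction n with
    | zero => ext; simp
    | succ n ih =>
      refine LinearMap.ext fun z => ?_
      rw [pow_succ', Module.End.mul_apply, ih]
      simp [f, Matrix.vecMul_vecMul, pow_succ]
  have hle := Module.End.ker_pow_le_ker_pow_finrank f (k + 1)
  rw [Module.finrank_fin_fun] at hle
  have hy : y ∈ LinearMap.ker (f ^ (k + 1)) := by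
    rw [LinearMap.mem_ker, hf]
    simpa [Matrix.vecMul_vecMul, pow_succ] using h
  have := hle hy
  rwa [LinearMap.mem_ker, hf] at this

theorem exists_vecMul_eq {x : Fin k → ℚ} (hx : x ∈ eventualRange A) :
    ∃ y ∈ eventualRange A, y ᵥ* ratMat A = x := by
  let g : eventualRange A →ₗ[ℚ] eventualRange A :=
    (ratMat A).vecMulLinear.restrict fun _ => vecMul_mem_eventualRange
  have hg : Function.Injective g := by
    rw [injective_iff_map_eq_zero]
    intro a ha
    exact Subtype.ext (eq_zero_of_vecMul_eq_zero a.2 (congr_arg Subtype.val ha))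
  obtain ⟨y, hy⟩ := LinearMap.surjective_of_injective hg ⟨x, hx⟩
  exact ⟨y, y.2, congr_arg Subtype.val hy⟩

end

/-- The group `𝒢_A` of those `x ∈ R(A)` with `x A^n` integral for some `n ≥ 0`. -/
def matGroup {k : ℕ} (A : Matrix (Fin k) (Fin k) ℕ) : AddSubgroup (Fin k → ℚ) where
  carrier := {x | x ∈ eventualRange A ∧
    ∃ (n : ℕ) (w : Fin k → ℤ), x ᵥ* ratMat A ^ n = fun i => (w i : ℚ)}
  zero_mem' := ⟨zero_mem _, 0, 0, by ext; simp⟩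
  add_mem' := by
    rintro x y ⟨hx, n, w, hw⟩ ⟨hy, n', w', hw'⟩
    refine ⟨add_mem hx hy, n + n', w ᵥ* (A.map (Nat.cast : ℕ → ℤ)) ^ n' +
      w' ᵥ* (A.map (Nat.cast : ℕ → ℤ)) ^ n, ?_⟩
    rw [Matrix.add_vecMul, pow_add, ← Matrix.vecMul_vecMul, hw, int_vecMul,
      ← pow_add, add_comm n n', pow_add, ← Matrix.vecMul_vecMul, hw', int_vecMul]
    ext i
    simp
  neg_mem' := by
    rintro x ⟨hx, n, w, hw⟩
    refine ⟨neg_mem hx, n, -w, ?_⟩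
    rw [Matrix.neg_vecMul, hw]
    ext i
    simp

/-- The positive cone `𝒢_A⁺`. -/
def matPos {k : ℕ} (A : Matrix (Fin k) (Fin k) ℕ) : Set (matGroup A) :=
  {x | ∃ (n : ℕ) (w : Fin k → ℕ), (x : Fin k → ℚ) ᵥ* ratMat A ^ n = fun i => (w i : ℚ)}

/-- The endomorphism `x ↦ x A` of `𝒢_A`. -/
def matMul {k : ℕ} (A : Matrix (Fin k) (Fin k) ℕ) : matGroup A →+ matGroup A where
  toFun x := ⟨(x : Fin k → ℚ) ᵥ* ratMat A, vecMul_mem_eventualRange x.2.1, by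
    obtain ⟨n, w, hw⟩ := x.2.2
    refine ⟨n, w ᵥ* (A.map (Nat.cast : ℕ → ℤ)) ^ 1, ?_⟩
    rw [← int_vecMul, ← hw, Matrix.vecMul_vecMul, Matrix.vecMul_vecMul, pow_one,
      ← pow_succ, ← pow_succ']⟩
  map_zero' := Subtype.ext (by simp)
  map_add' x y := Subtype.ext (by simp [Matrix.add_vecMul])

theorem matMul_bijective {k : ℕ} (A : Matrix (Fin k) (Fin k) ℕ) :
    Function.Bijective (matMul A) := by
  constructor
  · rw [injective_iff_map_eq_zero]
    intro x hx
    exact Subtype.ext (eq_zero_of_vecMul_eq_zero x.2.1 (congr_arg Subtype.val hx))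
  · rintro ⟨x, hx, n, w, hw⟩
    obtain ⟨y, hy, rfl⟩ := exists_vecMul_eq hx
    refine ⟨⟨y, hy, n + 1, w, ?_⟩, rfl⟩
    rw [pow_succ', ← Matrix.vecMul_vecMul, hw]

/-- Group automorphisms of `𝒢_A`. An additive automorphism is the same as a `ℤ`-linear one; in
this form composition is written as multiplication. -/
abbrev MatAut {k : ℕ} (A : Matrix (Fin k) (Fin k) ℕ) : Type := matGroup A ≃ₗ[ℤ] matGroup A

/-- The automorphism `δ_A : x ↦ x A` of `𝒢_A`. -/
def delta {k : ℕ} (A : Matrix (Fin k) (Fin k) ℕ) : MatAut A :=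
  (AddEquiv.ofBijective (matMul A) (matMul_bijective A)).toIntLinearEquiv

/-! ### The isomorphism `θ` -/

section

variable {k : ℕ} {A : Matrix (Fin k) (Fin k) ℕ}

theorem Irred.exists_edge (hA : Irred A) (i : Fin k) : ∃ e : Edge A, e.src = i := by
  have h := (Matrix.isIrreducible_iff_exists_pow_pos
    (A := A.map (Nat.cast : ℕ → ℝ)) (fun i j => by simp)).1 hA i i
  obtain ⟨n, hn, hpos⟩ := h
  obtain ⟨n, rfl⟩ := Nat.exists_eq_succ_of_ne_zero hn.ne'
  rw [Nat.succ_eq_add_one, pow_succ', Matrix.mul_apply] at hpos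
  obtain ⟨j, -, hj⟩ := Finset.exists_ne_zero_of_sum_ne_zero hpos.ne'
  have hij : A i j ≠ 0 := fun h0 => hj (by simp [h0])
  exact ⟨⟨i, j, ⟨0, Nat.pos_of_ne_zero hij⟩⟩, rfl⟩

theorem Irred.exists_extension (hA : Irred A) (x : Shift A) (m : ℤ) (e : Edge A)
    (he : (x m).tgt = e.src) : ∃ y ∈ ray x m, y (m + 1) = e := by
  choose s hs using hA.exists_edge
  let q : ℕ → Edge A := fun n => Nat.rec e (fun _ f => s f.tgt) n
  have hq : ∀ n, (q n).tgt = (q (n + 1)).src := fun n => (hs _).symm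
  refine ⟨⟨fun i => if i ≤ m then x i else q (i - m - 1).toNat, fun i => ?_⟩,
    fun i hi => if_pos hi, ?_⟩
  · beta_reduce
    rcases lt_trichotomy i m with hi | rfl | hi
    · rw [if_pos hi.le, if_pos (by omega)]
      exact x.adj i
    · rw [if_pos le_rfl, if_neg (by omega), show (i + 1 - i - 1).toNat = 0 by omega]
      exact he
    · rw [if_neg (by omega), if_neg (by omega),
        show (i + 1 - m - 1).toNat = (i - m - 1).toNat + 1 by omega]
      exact hq _
  · change (if m + 1 ≤ m then x (m + 1) else q (m + 1 - m - 1).toNat) = e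
    rw [if_neg (by omega), show (m + 1 - m - 1).toNat = 0 by omega]
    rfl

theorem ncard_edges (I J : Fin k) : {e : Edge A | e.src = I ∧ e.tgt = J}.ncard = A I J := by
  have : {e : Edge A | e.src = I ∧ e.tgt = J} =
      range (fun a : Fin (A I J) => (⟨I, J, a⟩ : Edge A)) := by
    ext ⟨i, j, a⟩
    constructor
    · rintro ⟨rfl, rfl⟩
      exact ⟨a, rfl⟩
    · rintro ⟨b, hb⟩
      cases hb
      exact ⟨rfl, rfl⟩
  rw [this, ← image_univ, ncard_image_of_injective, ncard_univ, Nat.card_fin]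
  intro a b hab
  simpa using hab

theorem beamVec_ray_succ (hA : Irred A) (x : Shift A) (m : ℤ) (J : Fin k) :
    beamVec (ray x m) (m + 1) J = A (x m).tgt J := by
  rw [beamVec, raysEndingAt, ncard_image_congr _ (fun y : Shift A => y (m + 1)),
    ← ncard_edges (A := A)]
  · congr 1
    ext e
    constructor
    · rintro ⟨y, ⟨hy, hJ⟩, rfl⟩
      exact ⟨by rw [← y.adj, hy m le_rfl], hJ⟩
    · rintro ⟨h1, h2⟩
      obtain ⟨y, hy, rfl⟩ := hA.exists_extension x m e h1.symm
      exact ⟨y, ⟨hy, h2⟩, rfl⟩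
  · intro y hy z hz
    simp only [ray_eq_iff]
    constructor
    · exact fun h => h _ le_rfl
    · intro h i hi
      rcases le_or_gt i m with hi' | hi'
      · rw [hy.1 i hi', hz.1 i hi']
      · obtain rfl : i = m + 1 := by omega
        exact h

/-- `v_{U,m}` as a rational row vector. -/
def beamVecQ (U : Set (Shift A)) (m : ℤ) : Fin k → ℚ := fun J => (beamVec U m J : ℚ)

theorem beamVecQ_succ (hA : Irred A) {m : ℤ} {U : Set (Shift A)} (hU : IsBeamAt m U) :
    beamVecQ U (m + 1) = beamVecQ U m ᵥ* ratMat A := by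
  let φ : Aut A := ⟨Homeomorph.refl _, fun _ => rfl⟩
  have hφ : ∀ V : Set (Shift A), φ '' V = V := fun V => image_id V
  ext J
  have := beamVec_image_eq_sum (φ := φ) (N := m + 1) hU
    (by rw [hφ]; exact hU.mono (by omega)) (fun y z h i hi => h i (by omega)) A
    (fun x _ J => by rw [hφ]; exact beamVec_ray_succ hA x m J) J
  rw [hφ] at this
  simp [beamVecQ, this, Matrix.vecMul, dotProduct]

/-- The element `v_{U,m} A^k` of `𝒢_A`. -/
def beamElt (U : Set (Shift A)) (m : ℤ) : matGroup A :=
  ⟨beamVecQ U m ᵥ* ratMat A ^ k, ⟨beamVecQ U m, rfl⟩, 0,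
    (fun J => (beamVec U m J : ℤ)) ᵥ* (A.map (Nat.cast : ℕ → ℤ)) ^ k, by
      rw [← int_vecMul, pow_zero, Matrix.vecMul_one]
      simp only [Int.cast_natCast]
      rfl⟩

/-- `δ_A^{-k-n} (v_{U,n} A^k)`, for an `n`-beam `U`. -/
def thetaAt (U : Set (Shift A)) (n : ℤ) : matGroup A :=
  (delta A ^ (-(k : ℤ) - n)) (beamElt U n)

theorem thetaAt_succ (hA : Irred A) {m : ℤ} {U : Set (Shift A)} (hU : IsBeamAt m U) :
    thetaAt U (m + 1) = thetaAt U m := by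
  have h : beamElt U (m + 1) = delta A (beamElt U m) := by
    refine Subtype.ext ?_
    change beamVecQ U (m + 1) ᵥ* ratMat A ^ k = (beamVecQ U m ᵥ* ratMat A ^ k) ᵥ* ratMat A
    rw [beamVecQ_succ hA hU, Matrix.vecMul_vecMul, Matrix.vecMul_vecMul, ← pow_succ, ← pow_succ']
  unfold thetaAt
  rw [h, ← LinearEquiv.mul_apply, ← zpow_add_one]
  congr 2
  ring

theorem thetaAt_eq (hA : Irred A) {m n : ℤ} {U : Set (Shift A)} (hU : IsBeamAt m U)
    (h : m ≤ n) : thetaAt U n = thetaAt U m := by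
  induction n, h using Int.leInduction with
  | base => rfl
  | succ n hn ih => rw [thetaAt_succ hA (hU.mono hn), ih]

theorem thetaAt_choose (hA : Irred A) (U : Beam A) {n : ℤ} (h : IsBeamAt n U.1) :
    thetaAt U.1 U.2.choose = thetaAt U.1 n := by
  rw [← thetaAt_eq hA U.2.choose_spec (le_max_left _ n), thetaAt_eq hA h (le_max_right _ n)]

/-- The homomorphism `θ : D_A → 𝒢_A` with `θ [U] = δ_A^{-k-n} (v_{U,n} A^k)` for every
`n`-beam `U`. -/
def theta (hA : Irred A) : DimGroup A →+ matGroup A :=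
  dimLift (fun U => thetaAt U.1 U.2.choose)
    (fun U V h => by
      obtain ⟨m, hU, hV, hv⟩ := h
      rw [thetaAt_choose hA U hU, thetaAt_choose hA V hV]
      have : beamVecQ U.1 m = beamVecQ V.1 m := funext fun J => by simp [beamVecQ, hv J]
      simp only [thetaAt, beamElt, this])
    (fun U V W hd hW => by
      obtain ⟨m, hU⟩ := U.2
      obtain ⟨n, hV⟩ := V.2
      replace hU := hU.mono (le_max_left m n)
      replace hV := hV.mono (le_max_right m n)
      have hW' : IsBeamAt (max m n) W.1 := hW ▸ hU.union hV
      rw [thetaAt_choose hA U hU, thetaAt_choose hA V hV, thetaAt_choose hA W hW']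
      unfold thetaAt
      rw [← map_add]
      congr 1
      refine Subtype.ext ?_
      change beamVecQ W.1 _ ᵥ* ratMat A ^ k =
        beamVecQ U.1 _ ᵥ* ratMat A ^ k + beamVecQ V.1 _ ᵥ* ratMat A ^ k
      rw [← Matrix.add_vecMul]
      congr 1
      ext J
      simp [beamVecQ, hW, beamVec_union hU hV hd J])

theorem theta_beamClass (hA : Irred A) (U : Beam A) {n : ℤ} (h : IsBeamAt n U.1) :
    theta hA (beamClass U) = (delta A ^ (-(k : ℤ) - n)) (beamElt U.1 n) := by
  rw [theta, dimLift_beamClass, thetaAt_choose hA U h, thetaAt]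

/-- `S` is the automorphism `S_φ` of the triple `(𝒢_A, 𝒢_A⁺, δ_A)` that corresponds to `φ_*`
under `θ`. -/
structure IsDimRep (hA : Irred A) (φ : Aut A) (S : MatAut A) : Prop where
  /-- the square formed by `θ`, `φ_*` and `S` commutes -/
  comm : ∀ d, S (theta hA d) = theta hA (φ.dimMap d)
  /-- `S` maps the positive cone onto itself -/
  pos : ∀ g, S g ∈ matPos A ↔ g ∈ matPos A
  /-- `S` commutes with `δ_A` -/
  comm_delta : ∀ g, S (delta A g) = delta A (S g)

/-- The complexification `S ⊗ 1` of an automorphism of `𝒢_A`. -/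
def complexify (S : MatAut A) : (ℂ ⊗[ℤ] matGroup A) →ₗ[ℂ] (ℂ ⊗[ℤ] matGroup A) :=
  S.toLinearMap.baseChange ℂ

end

/-! ### Measures on unstable sets -/

/-- The Perron–Frobenius eigenvalue `λ_A`: the spectral radius of `A`. -/
def perron {k : ℕ} (A : Matrix (Fin k) (Fin k) ℕ) : ℝ :=
  (spectralRadius ℂ (A.map (Nat.cast : ℕ → ℂ))).toReal

section

variable {k : ℕ} {A : Matrix (Fin k) (Fin k) ℕ}

/-- The unstable set `W^u(x) = ⋃ₙ R(x, n)`. -/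
structure Unstable (x : Shift A) where
  /-- the underlying point of `X_A` -/
  pt : Shift A
  mem : pt ∈ ⋃ n : ℤ, ray x n

/-- The part of `W^u(x)` in the ray `R(y, m)` (this is all of `R(y, m)` if `y ∈ W^u(x)`). -/
def unstableRay (x y : Shift A) (m : ℤ) : Set (Unstable x) := {z | z.pt ∈ ray y m}

/-- The topology on `W^u(x)` with basis the rays `R(y, m)`, `y ∈ W^u(x)`. -/
instance (x : Shift A) : TopologicalSpace (Unstable x) :=
  TopologicalSpace.generateFrom {U | ∃ (y : Unstable x) (m : ℤ), U = unstableRay x y.pt m}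

instance (x : Shift A) : MeasurableSpace (Unstable x) := borel _

instance (x : Shift A) : BorelSpace (Unstable x) := ⟨rfl⟩

/-- The map `W^u(x) → W^u(φ(x))` induced by an automorphism `φ`. -/
def Aut.unstableMap (φ : Aut A) (x : Shift A) (y : Unstable x) : Unstable (φ x) :=
  ⟨φ y.pt, by
    obtain ⟨r, hr, -⟩ := φ.exists_range
    obtain ⟨n, hn⟩ := mem_iUnion.1 y.mem
    exact mem_iUnion.2 ⟨n - r, hr.agree hn⟩⟩

/-- The family `μ` of Borel measures on the unstable sets is the one given by some positive
right eigenvector `v_r` of `A` for `λ_A`, i.e. `μ^x(R(y, m)) = λ_A^{-m} v_r(t(y_m))`. -/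
def IsUnstableMeasureFamily (μ : ∀ x : Shift A, Measure (Unstable x)) : Prop :=
  ∃ v : Fin k → ℝ, (∀ i, 0 < v i) ∧ A.map (Nat.cast : ℕ → ℝ) *ᵥ v = perron A • v ∧
    ∀ (x : Shift A) (y : Unstable x) (m : ℤ),
      μ x (unstableRay x y.pt m) = ENNReal.ofReal (perron A ^ (-m) * v (y.pt m).tgt)

/-- `τ` is the state on `D_A` that corresponds to the family `μ`:
a homomorphism, nonnegative on the classes of beams, with `τ [R(x, n)] = μ^x(R(x, n))`. -/
structure IsState (μ : ∀ x : Shift A, Measure (Unstable x)) (τ : DimGroup A →+ ℝ) : Prop where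
  nonneg : ∀ U : Beam A, 0 ≤ τ (beamClass U)
  ray : ∀ (x : Shift A) (n : ℤ), τ (beamClass (rayBeam x n)) = (μ x (unstableRay x x n)).toReal

/-- `φ` multiplies the canonical measures on unstable sets by `c`:
`μ^{φ(x)}(φ(S)) = c μ^x(S)` for every point `x` and every Borel set `S ⊆ W^u(x)`. -/
def ScalesMeasures (φ : Aut A) (c : ℝ) : Prop :=
  ∀ μ : ∀ x : Shift A, Measure (Unstable x), IsUnstableMeasureFamily μ →
    ∀ (x : Shift A) (S : Set (Unstable x)), MeasurableSet S →
      μ (φ x) (φ.unstableMap x '' S) = ENNReal.ofReal c * μ x S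

/-- `φ_*` multiplies the canonical states on `D_A` by `c`. -/
def ScalesState (φ : Aut A) (c : ℝ) : Prop :=
  ∀ (μ : ∀ x : Shift A, Measure (Unstable x)) (τ : DimGroup A →+ ℝ),
    IsUnstableMeasureFamily μ → IsState μ τ → ∀ d, τ (φ.dimMap d) = c * τ d

/-- `S_φ ⊗ 1` acts on the `λ_A`-eigenspace of `δ_A ⊗ 1` as multiplication by `c`. -/
def IsPerronEigenvalue (hA : Irred A) (φ : Aut A) (c : ℂ) : Prop :=
  ∀ S : MatAut A, IsDimRep hA φ S → ∀ v : ℂ ⊗[ℤ] matGroup A,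
    complexify (delta A) v = (perron A : ℂ) • v → complexify S v = c • v

end

end SFT

end

/-
A Perron vector `v` gives a state `[U] ↦ λ_A^{-m} ⟨v_{U,m}, v⟩` on `D_A`, and every homomorphism
`D_A → ℝ` on which the shift acts by the same factor arises so from a unique `λ_A`-eigenvector.
Since `φ_*` commutes with the shift and `v` is unique up to scaling, `φ_*` multiplies every state
by one number `λ_φ`. A canonical measure is the extension of the content on beams given by its
state, and the Perron eigenline of `𝒢_A ⊗ ℂ` pairs nontrivially with `v`, so `λ_φ` is also the
factor on measures and on that eigenline. For the entropy bound, the state of `φ^n(R(x, 0))` is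
`λ_φ^n` times that of `R(x, 0)`, while a dynamical cover of `X_A` of size `N` at time `n + 1` gives
a cover of `φ^n(R(x, 0))` by `N` rays of a fixed level. The inverse of `φ` has the same entropy and
the factor `λ_φ⁻¹`.
-/

/-! ### Perron–Frobenius theory -/

namespace PerronFrobenius

open Matrix

variable {n : Type*} [Fintype n] {B : Matrix n n ℝ}

theorem dotProduct_pos {u v : n → ℝ} (hu : ∀ i, 0 < u i) (hv : 0 ≤ v) (hv0 : v ≠ 0) :
    0 < u ⬝ᵥ v := by
  obtain ⟨j, hj⟩ := Function.ne_iff.1 hv0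
  exact Finset.sum_pos' (fun i _ => mul_nonneg (hu i).le (hv i))
    ⟨j, Finset.mem_univ _, mul_pos (hu j) ((hv j).lt_of_ne' hj)⟩

theorem eigenvalue_eq_of_pos {u v : n → ℝ} {r s : ℝ} (hu : ∀ i, 0 < u i) (hv : 0 ≤ v)
    (hv0 : v ≠ 0) (hul : u ᵥ* B = s • u) (hvr : B *ᵥ v = r • v) : s = r := by
  have h := dotProduct_mulVec u B v
  rw [hul, hvr, dotProduct_smul, smul_dotProduct] at h
  exact (mul_right_cancel₀ (dotProduct_pos hu hv hv0).ne' h).symm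

theorem pow_mulVec_eq_smul {R : Type*} [CommSemiring R] [DecidableEq n] {B : Matrix n n R}
    {v : n → R} {r : R} (h : B *ᵥ v = r • v) (m : ℕ) : B ^ m *ᵥ v = r ^ m • v := by
  induction m with
  | zero => simp
  | succ m ih => rw [pow_succ, ← mulVec_mulVec, h, mulVec_smul, ih, smul_smul, pow_succ']

theorem exists_sum_pow_pos [DecidableEq n] (hB : B.IsIrreducible) :
    ∃ M : ℕ, ∀ i j, 0 < (∑ m ∈ Finset.range M, B ^ m) i j := by
  choose p _ hp using (isIrreducible_iff_exists_pow_pos hB.nonneg).1 hB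
  obtain ⟨M, hM⟩ := (Set.finite_range fun q : n × n => p q.1 q.2).bddAbove
  refine ⟨M + 1, fun i j => ?_⟩
  rw [Matrix.sum_apply]
  exact Finset.sum_pos' (fun m _ => pow_apply_nonneg hB.nonneg m i j)
    ⟨p i j, Finset.mem_range.2 (Nat.lt_succ_of_le (hM ⟨(i, j), rfl⟩)), hp i j⟩

theorem pos_of_mulVec_eq_smul (hB : B.IsIrreducible) {v : n → ℝ} {r : ℝ} (hv : 0 ≤ v)
    (hv0 : v ≠ 0) (h : B *ᵥ v = r • v) (i : n) : 0 < v i := by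
  classical
  obtain ⟨M, hM⟩ := exists_sum_pow_pos hB
  have hPv : (∑ m ∈ Finset.range M, B ^ m) *ᵥ v = (∑ m ∈ Finset.range M, r ^ m) • v := by
    rw [sum_mulVec, Finset.sum_smul]
    exact Finset.sum_congr rfl fun m _ => pow_mulVec_eq_smul h m
  have hpos : 0 < ((∑ m ∈ Finset.range M, B ^ m) *ᵥ v) i := dotProduct_pos (hM i) hv hv0
  rw [hPv] at hpos
  exact (hv i).lt_of_ne fun h0 => by simp [← h0] at hpos

/-- The pairs `(t, x)` with `0 ≤ t`, `x` a probability vector and `t x ≤ B x`. The largest such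
`t` is the Perron eigenvalue of an irreducible `B`. -/
def collatzWielandt (B : Matrix n n ℝ) : Set (ℝ × (n → ℝ)) :=
  {p | 0 ≤ p.1 ∧ p.2 ∈ stdSimplex ℝ n ∧ p.1 • p.2 ≤ B *ᵥ p.2}

theorem le_sum_of_mem_collatzWielandt (hB : ∀ i j, 0 ≤ B i j) {p : ℝ × (n → ℝ)}
    (hp : p ∈ collatzWielandt B) : p.1 ≤ ∑ i, ∑ j, B i j := by
  obtain ⟨-, ⟨hx0, hx1⟩, hle⟩ := hp
  calc p.1 = ∑ i, p.1 * p.2 i := by rw [← Finset.mul_sum, hx1, mul_one]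
    _ ≤ ∑ i, (B *ᵥ p.2) i := Finset.sum_le_sum fun i _ => hle i
    _ ≤ ∑ i, ∑ j, B i j := by
      refine Finset.sum_le_sum fun i _ => Finset.sum_le_sum fun j _ =>
        mul_le_of_le_one_right (hB i j) ?_
      rw [← hx1]
      exact Finset.single_le_sum (fun l _ => hx0 l) (Finset.mem_univ j)

theorem isCompact_collatzWielandt (hB : ∀ i j, 0 ≤ B i j) : IsCompact (collatzWielandt B) := by
  have hcont : Continuous fun p : ℝ × (n → ℝ) => B *ᵥ p.2 :=
    continuous_const.matrix_mulVec continuous_snd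
  have hclosed : IsClosed (collatzWielandt B) :=
    (isClosed_Ici.preimage continuous_fst).inter
      (((isCompact_stdSimplex ℝ n).isClosed.preimage continuous_snd).inter
        (isClosed_le (by fun_prop) hcont))
  exact (isCompact_Icc.prod (isCompact_stdSimplex ℝ n)).of_isClosed_subset hclosed
    fun p hp => ⟨⟨hp.1, le_sum_of_mem_collatzWielandt hB hp⟩, hp.2.1⟩

theorem collatzWielandt_nonempty [Nonempty n] (hB : ∀ i j, 0 ≤ B i j) :
    (collatzWielandt B).Nonempty := by
  classical
  obtain ⟨i⟩ := ‹Nonempty n›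
  exact ⟨(0, Pi.single i 1), le_rfl, single_mem_stdSimplex ℝ i, fun j => by simpa using hB j i⟩

theorem smul_mem_collatzWielandt {t : ℝ} {y : n → ℝ} (ht : 0 ≤ t) (hy : 0 ≤ y) (hy0 : y ≠ 0)
    (hle : t • y ≤ B *ᵥ y) : (t, (∑ i, y i)⁻¹ • y) ∈ collatzWielandt B := by
  have hs : 0 < ∑ i, y i := by
    simpa [dotProduct] using dotProduct_pos (u := fun _ => 1) (fun _ => one_pos) hy hy0
  refine ⟨ht, ⟨fun i => mul_nonneg (inv_nonneg.2 hs.le) (hy i), ?_⟩, ?_⟩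
  · simp only [Pi.smul_apply, smul_eq_mul, ← Finset.mul_sum, inv_mul_cancel₀ hs.ne']
  · rw [mulVec_smul, smul_comm]
    exact smul_le_smul_of_nonneg_left hle (inv_nonneg.2 hs.le)

theorem exists_smul_le {ι : Type*} [Finite ι] [Nonempty ι] {y w : ι → ℝ} (hy : ∀ i, 0 < y i)
    (hw : ∀ i, 0 < w i) : ∃ ε : ℝ, 0 < ε ∧ ε • y ≤ w := by
  obtain ⟨i, hi⟩ := Finite.exists_min fun i => w i / y i
  exact ⟨w i / y i, div_pos (hw i) (hy i), fun j => (le_div_iff₀ (hy j)).1 (hi j)⟩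

-- With `P` a positive sum of powers of `B`, replacing `x` by `P x` makes `t x ≤ B x` strict in
-- every coordinate.
theorem exists_lt_mem_collatzWielandt [Nonempty n] (hB : B.IsIrreducible) {t : ℝ} {x : n → ℝ}
    (hp : (t, x) ∈ collatzWielandt B) (hne : B *ᵥ x ≠ t • x) :
    ∃ q ∈ collatzWielandt B, t < q.1 := by
  classical
  obtain ⟨ht, hx, hle⟩ := hp
  have hx0 : x ≠ 0 := by
    rintro rfl
    simpa using hx.2
  obtain ⟨M, hM⟩ := exists_sum_pow_pos hB
  set P := ∑ m ∈ Finset.range M, B ^ m with hP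
  have hcomm : B * P = P * B := by
    rw [hP, Finset.mul_sum, Finset.sum_mul]
    exact Finset.sum_congr rfl fun m _ => (Commute.self_pow B m).eq
  have hy (i) : 0 < (P *ᵥ x) i := dotProduct_pos (hM i) hx.1 hx0
  have hw (i) : 0 < (P *ᵥ (B *ᵥ x - t • x)) i :=
    dotProduct_pos (hM i) (sub_nonneg.2 hle) (sub_ne_zero.2 hne)
  have hBy : B *ᵥ (P *ᵥ x) = t • (P *ᵥ x) + P *ᵥ (B *ᵥ x - t • x) := by
    rw [mulVec_sub, mulVec_smul, mulVec_mulVec, mulVec_mulVec, hcomm, add_sub_cancel]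
  obtain ⟨ε, hε, hεy⟩ := exists_smul_le hy hw
  refine ⟨_, smul_mem_collatzWielandt (t := t + ε) (by positivity) (fun i => (hy i).le) ?_ ?_,
    lt_add_of_pos_right t hε⟩
  · exact Function.ne_iff.2 ⟨Classical.arbitrary n, (hy _).ne'⟩
  · rw [add_smul, hBy]
    exact add_le_add_right hεy _

theorem exists_pos_eigenvector [Nonempty n] (hB : B.IsIrreducible) :
    ∃ (r : ℝ) (v : n → ℝ), 0 ≤ r ∧ (∀ i, 0 < v i) ∧ B *ᵥ v = r • v := by
  obtain ⟨⟨t, x⟩, hp, hmax⟩ := (isCompact_collatzWielandt hB.nonneg).exists_isMaxOn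
    (collatzWielandt_nonempty hB.nonneg) continuous_fst.continuousOn
  have heq : B *ᵥ x = t • x := by
    by_contra hne
    obtain ⟨q, hq, hlt⟩ := exists_lt_mem_collatzWielandt hB hp hne
    exact hlt.not_ge (hmax hq)
  obtain ⟨ht, hx, -⟩ := hp
  have hx0 : x ≠ 0 := by
    rintro rfl
    simpa using hx.2
  exact ⟨t, x, ht, pos_of_mulVec_eq_smul hB hx.1 hx0 heq, heq⟩

theorem eigenvector_unique [Nonempty n] (hB : B.IsIrreducible) {v w : n → ℝ} {r : ℝ}
    (hv : ∀ i, 0 < v i) (h : B *ᵥ v = r • v) (hw : B *ᵥ w = r • w) : ∃ t : ℝ, w = t • v := by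
  obtain ⟨i, hi⟩ := Finite.exists_min fun i => w i / v i
  refine ⟨w i / v i, ?_⟩
  by_contra hne
  have hle : (w i / v i) • v ≤ w := fun j => (le_div_iff₀ (hv j)).1 (hi j)
  have hpos := pos_of_mulVec_eq_smul hB (sub_nonneg.2 hle) (sub_ne_zero.2 hne)
    (by rw [mulVec_sub, mulVec_smul, h, hw, smul_sub, smul_comm]) i
  simp [div_mul_cancel₀ _ (hv i).ne'] at hpos

theorem map_ofReal_mulVec_eq_smul {v : n → ℝ} {r : ℝ} (h : B *ᵥ v = r • v) :
    B.map ((↑) : ℝ → ℂ) *ᵥ (fun i => (v i : ℂ)) = (r : ℂ) • fun i => (v i : ℂ) := by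
  ext i
  simpa [mulVec, dotProduct] using congr_arg ((↑) : ℝ → ℂ) (congr_fun h i)

theorem norm_eigenvalue_le (hB : ∀ i j, 0 ≤ B i j) {u : n → ℝ} {s : ℝ} (hu : ∀ i, 0 < u i)
    (hul : u ᵥ* B = s • u) {w : n → ℂ} {z : ℂ} (hw0 : w ≠ 0)
    (hw : B.map ((↑) : ℝ → ℂ) *ᵥ w = z • w) : ‖z‖ ≤ s := by
  have hle : ‖z‖ • (fun j => ‖w j‖) ≤ B *ᵥ fun j => ‖w j‖ := fun i => by
    rw [Pi.smul_apply, smul_eq_mul, ← norm_mul, ← smul_eq_mul, ← Pi.smul_apply, ← hw]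
    refine (norm_sum_le _ _).trans (Finset.sum_le_sum fun j _ => ?_)
    simp [abs_of_nonneg (hB i j)]
  have hpos : 0 < u ⬝ᵥ fun j => ‖w j‖ :=
    dotProduct_pos hu (fun j => norm_nonneg (w j)) fun h0 =>
      hw0 (funext fun j => norm_eq_zero.1 (congr_fun h0 j))
  refine le_of_mul_le_mul_right ?_ hpos
  calc ‖z‖ * (u ⬝ᵥ fun j => ‖w j‖) = u ⬝ᵥ (‖z‖ • fun j => ‖w j‖) := by
        rw [dotProduct_smul, smul_eq_mul]
    _ ≤ u ⬝ᵥ (B *ᵥ fun j => ‖w j‖) :=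
        Finset.sum_le_sum fun i _ => mul_le_mul_of_nonneg_left (hle i) (hu i).le
    _ = s * (u ⬝ᵥ fun j => ‖w j‖) := by
        rw [dotProduct_mulVec, hul, smul_dotProduct, smul_eq_mul]

theorem mem_spectrum_of_mulVec_eq_smul {R : Type*} [CommRing R] [DecidableEq n]
    {C : Matrix n n R} {w : n → R} {z : R} (hw0 : w ≠ 0) (hw : C *ᵥ w = z • w) :
    z ∈ spectrum R C := by
  rw [← spectrum_toLin']
  exact (Module.End.hasEigenvalue_of_hasEigenvector (f := C.toLin') (x := w)
    ⟨Module.End.mem_eigenspace_iff.2 (by rwa [toLin'_apply]), hw0⟩).mem_spectrum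

theorem spectralRadius_eq [DecidableEq n] (hB : ∀ i j, 0 ≤ B i j) {u v : n → ℝ} {r : ℝ}
    (hr : 0 ≤ r) (hu : ∀ i, 0 < u i) (hul : u ᵥ* B = r • u) (hv0 : v ≠ 0) (hvr : B *ᵥ v = r • v) :
    spectralRadius ℂ (B.map ((↑) : ℝ → ℂ)) = ENNReal.ofReal r := by
  refine le_antisymm (iSup₂_le fun z hz => ?_) ?_
  · rw [← spectrum_toLin', ← Module.End.hasEigenvalue_iff_mem_spectrum] at hz
    obtain ⟨w, hw⟩ := hz.exists_hasEigenvector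
    rw [← enorm_eq_nnnorm, ← ofReal_norm]
    exact ENNReal.ofReal_le_ofReal
      (norm_eigenvalue_le hB hu hul hw.2 (by simpa using hw.apply_eq_smul))
  · have hmem : (r : ℂ) ∈ spectrum ℂ (B.map ((↑) : ℝ → ℂ)) := by
      refine mem_spectrum_of_mulVec_eq_smul (fun h0 => hv0 (funext fun i => ?_))
        (map_ofReal_mulVec_eq_smul hvr)
      simpa using congr_fun h0 i
    calc ENNReal.ofReal r = (‖(r : ℂ)‖₊ : ENNReal) := by
          rw [← enorm_eq_nnnorm, ← ofReal_norm, Complex.norm_real, Real.norm_of_nonneg hr]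
      _ ≤ _ := le_iSup₂ (f := fun z (_ : z ∈ spectrum ℂ (B.map ((↑) : ℝ → ℂ))) =>
          (‖z‖₊ : ENNReal)) (r : ℂ) hmem

end PerronFrobenius

namespace SFT

variable {k : ℕ} {A : Matrix (Fin k) (Fin k) ℕ}

theorem Irred.exists_perron_eigenvectors [Nonempty (Fin k)] (hA : Irred A) :
    ∃ u v : Fin k → ℝ, (∀ i, 0 < u i) ∧ (∀ i, 0 < v i) ∧
      u ᵥ* A.map (Nat.cast : ℕ → ℝ) = perron A • u ∧
      A.map (Nat.cast : ℕ → ℝ) *ᵥ v = perron A • v := by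
  obtain ⟨r, v, hr, hv, hvr⟩ := PerronFrobenius.exists_pos_eigenvector hA
  obtain ⟨s, u, -, hu, hul⟩ := PerronFrobenius.exists_pos_eigenvector hA.transpose
  rw [Matrix.mulVec_transpose] at hul
  have hv0 : v ≠ 0 := Function.ne_iff.2 ⟨Classical.arbitrary _, (hv _).ne'⟩
  obtain rfl := PerronFrobenius.eigenvalue_eq_of_pos hu (fun i => (hv i).le) hv0 hul hvr
  have hperron : perron A = s := by
    have hmap : A.map (Nat.cast : ℕ → ℂ) = (A.map (Nat.cast : ℕ → ℝ)).map ((↑) : ℝ → ℂ) := by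
      ext; simp
    rw [perron, hmap, PerronFrobenius.spectralRadius_eq hA.nonneg hr hu hul hv0 hvr,
      ENNReal.toReal_ofReal hr]
  rw [hperron]
  exact ⟨u, v, hu, hv, hul, hvr⟩

theorem Irred.perron_pos [Nonempty (Fin k)] (hA : Irred A) : 0 < perron A := by
  obtain ⟨-, v, -, hv, -, hvr⟩ := hA.exists_perron_eigenvectors
  obtain ⟨e, -⟩ := hA.exists_edge (Classical.arbitrary _)
  have hpos : 0 < (A.map (Nat.cast : ℕ → ℝ) *ᵥ v) e.src :=
    Finset.sum_pos' (fun j _ => mul_nonneg (by simp) (hv j).le)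
      ⟨e.tgt, Finset.mem_univ _, mul_pos (by simpa using e.idx.pos) (hv _)⟩
  rw [hvr] at hpos
  exact pos_of_mul_pos_left hpos (hv _).le

theorem Irred.left_eigenvector_unique [Nonempty (Fin k)] (hA : Irred A) {u : Fin k → ℝ}
    (hu : ∀ i, 0 < u i) (hul : u ᵥ* A.map (Nat.cast : ℕ → ℝ) = perron A • u) {w : Fin k → ℂ}
    (hw : w ᵥ* A.map (Nat.cast : ℕ → ℂ) = (perron A : ℂ) • w) :
    ∃ t : ℂ, w = t • fun i => (u i : ℂ) := by
  rw [← Matrix.mulVec_transpose] at hul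
  have hre : (A.map (Nat.cast : ℕ → ℝ))ᵀ *ᵥ (fun i => (w i).re) = perron A • fun i => (w i).re := by
    ext i
    simpa [Matrix.mulVec_transpose, Matrix.vecMul, dotProduct] using
      congr_arg Complex.re (congr_fun hw i)
  have him : (A.map (Nat.cast : ℕ → ℝ))ᵀ *ᵥ (fun i => (w i).im) = perron A • fun i => (w i).im := by
    ext i
    simpa [Matrix.mulVec_transpose, Matrix.vecMul, dotProduct] using
      congr_arg Complex.im (congr_fun hw i)
  obtain ⟨a, ha⟩ := PerronFrobenius.eigenvector_unique hA.transpose hu hul hre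
  obtain ⟨b, hb⟩ := PerronFrobenius.eigenvector_unique hA.transpose hu hul him
  refine ⟨⟨a, b⟩, funext fun i => Complex.ext ?_ ?_⟩
  · simpa using congr_fun ha i
  · simpa using congr_fun hb i

/-! ### The dimension group as the direct limit of `ℤ^k` under `A` -/

theorem Irred.exists_edge_tgt (hA : Irred A) (j : Fin k) : ∃ e : Edge A, e.tgt = j := by
  obtain ⟨n, hn, hpos⟩ := (Matrix.isIrreducible_iff_exists_pow_pos
    (A := A.map (Nat.cast : ℕ → ℝ)) (fun i j => by simp)).1 hA j j
  obtain ⟨n, rfl⟩ := Nat.exists_eq_succ_of_ne_zero hn.ne'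
  rw [Nat.succ_eq_add_one, pow_succ, Matrix.mul_apply] at hpos
  obtain ⟨i, -, hi⟩ := Finset.exists_ne_zero_of_sum_ne_zero hpos.ne'
  have hij : A i j ≠ 0 := fun h0 => hi (by simp [h0])
  exact ⟨⟨i, j, ⟨0, Nat.pos_of_ne_zero hij⟩⟩, rfl⟩

theorem Irred.exists_point (hA : Irred A) (m : ℤ) (J : Fin k) :
    ∃ x : Shift A, (x m).tgt = J := by
  choose next hnext using hA.exists_edge
  choose prev hprev using hA.exists_edge_tgt
  let future : ℕ → Edge A := fun n => Nat.rec (next J) (fun _ f => next f.tgt) n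
  let past : ℕ → Edge A := fun n => Nat.rec (prev J) (fun _ f => prev f.src) n
  have hfuture (n) : (future n).tgt = (future (n + 1)).src := (hnext _).symm
  have hpast (n) : (past (n + 1)).tgt = (past n).src := hprev _
  refine ⟨⟨fun i => if i ≤ m then past (m - i).toNat else future (i - m - 1).toNat,
    fun i => ?_⟩, ?_⟩
  · beta_reduce
    rcases lt_trichotomy i m with hi | rfl | hi
    · rw [if_pos hi.le, if_pos (by omega), show (m - i).toNat = (m - (i + 1)).toNat + 1 by omega]
      exact hpast _
    · rw [if_pos le_rfl, if_neg (by omega), show (i + 1 - i - 1).toNat = 0 by omega, sub_self]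
      exact (hprev J).trans (hnext J).symm
    · rw [if_neg (by omega), if_neg (by omega),
        show (i + 1 - m - 1).toNat = (i - m - 1).toNat + 1 by omega]
      exact hfuture _
  · change (if m ≤ m then past (m - m).toNat else _).tgt = J
    rw [if_pos le_rfl, sub_self]
    exact hprev J

theorem isBeamAt_empty (m : ℤ) : IsBeamAt m (∅ : Set (Shift A)) := ⟨∅, finite_empty, by simp⟩

theorem isBeamAt_ray (x : Shift A) (m : ℤ) : IsBeamAt m (ray x m) :=
  ⟨{x}, finite_singleton x, by simp⟩

theorem IsBeamAt.induction {m : ℤ} {p : Set (Shift A) → Prop} (empty : p ∅)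
    (union_ray : ∀ U x, IsBeamAt m U → Disjoint U (ray x m) → p U → p (U ∪ ray x m))
    {U : Set (Shift A)} (hU : IsBeamAt m U) : p U := by
  obtain ⟨s, hs, rfl⟩ := hU
  induction s, hs using Set.Finite.induction_on with
  | empty => simpa using empty
  | @insert x s _ hs ih =>
    rw [biUnion_insert, union_comm]
    have hb : IsBeamAt m (⋃ x ∈ s, ray x m) := ⟨s, hs, rfl⟩
    by_cases hx : Disjoint (⋃ x ∈ s, ray x m) (ray x m)
    · exact union_ray _ x hb hx ih
    · obtain ⟨y, hy, hyx⟩ := Set.not_disjoint_iff.1 hx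
      rwa [union_eq_self_of_subset_right]
      rw [← ray_eq_of_mem hyx]
      exact (isBeamAt_iff.1 hb).1 y hy

theorem beamVec_empty (m : ℤ) : beamVec (∅ : Set (Shift A)) m = 0 := by
  ext J
  simp [beamVec, raysEndingAt]

theorem beamVec_ray (x : Shift A) (m : ℤ) : beamVec (ray x m) m = Pi.single (x m).tgt 1 := by
  ext J
  rcases eq_or_ne J (x m).tgt with rfl | hJ
  · rw [Pi.single_eq_same, beamVec, ncard_eq_one]
    refine ⟨ray x m, Subset.antisymm ?_ ?_⟩
    · rintro _ ⟨y, hy, rfl⟩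
      exact ray_eq_of_mem hy.1
    · rintro _ rfl
      exact ⟨x, ⟨self_mem_ray x m, rfl⟩, rfl⟩
  · rw [Pi.single_eq_of_ne hJ, beamVec,
      eq_empty_of_forall_notMem (s := raysEndingAt (ray x m) m J) ?_, ncard_empty]
    rintro _ ⟨y, ⟨hy, rfl⟩, rfl⟩
    exact hJ (by rw [hy m le_rfl])

theorem beamClass_of_eq_empty {U : Beam A} (hU : U.1 = ∅) : beamClass U = 0 := by
  have hunion : beamClass U = beamClass U + beamClass U :=
    beamClass_union (by rw [hU]; exact disjoint_bot_left) (union_self _).symm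
  simpa using hunion

theorem dimGroup_induction {p : DimGroup A → Prop} (beam : ∀ U, p (beamClass U))
    (neg : ∀ d, p d → p (-d)) (add : ∀ d e, p d → p e → p (d + e)) (d : DimGroup A) : p d := by
  induction d using QuotientAddGroup.induction_on with
  | H z =>
    induction z using FreeAbelianGroup.induction_on with
    | zero =>
      rw [QuotientAddGroup.mk_zero, ← beamClass_of_eq_empty (U := ⟨∅, 0, isBeamAt_empty 0⟩) rfl]
      exact beam _
    | of U => exact beam U
    | neg U hU => exact neg _ hU
    | add x y hx hy => exact add _ _ hx hy

theorem dimGroup_hom_ext {G : Type*} [AddCommGroup G] {f g : DimGroup A →+ G}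
    (h : ∀ U, f (beamClass U) = g (beamClass U)) : f = g :=
  QuotientAddGroup.addMonoidHom_ext _ (FreeAbelianGroup.lift_ext _ _ fun U => h U)

/-- The common class in `D_A` of the rays `R(x, m)` with `t(x_m) = J`. -/
noncomputable def stateClass (hA : Irred A) (m : ℤ) (J : Fin k) : DimGroup A :=
  beamClass (rayBeam (hA.exists_point m J).choose m)

theorem beamClass_rayBeam (hA : Irred A) (x : Shift A) (m : ℤ) :
    beamClass (rayBeam x m) = stateClass hA m (x m).tgt := by
  refine beamClass_eq ⟨m, isBeamAt_ray x m, isBeamAt_ray _ m, fun J => ?_⟩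
  change beamVec (ray x m) m J = beamVec (ray _ m) m J
  rw [beamVec_ray, beamVec_ray, (hA.exists_point m (x m).tgt).choose_spec]

/-- The map `ℤ^k → D_A` at level `m` of the direct limit: it sends `v_{U,m}` to `[U]` for every
`m`-beam `U`. -/
noncomputable def classOfVec (hA : Irred A) (m : ℤ) : (Fin k → ℤ) →ₗ[ℤ] DimGroup A :=
  Fintype.linearCombination ℤ (stateClass hA m)

theorem classOfVec_single (hA : Irred A) (m : ℤ) (J : Fin k) :
    classOfVec hA m (Pi.single J 1) = stateClass hA m J := by
  simp [classOfVec, Fintype.linearCombination_apply_single]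

theorem beamClass_eq_classOfVec (hA : Irred A) {m : ℤ} {U : Beam A} (hU : IsBeamAt m U.1) :
    beamClass U = classOfVec hA m fun J => (beamVec U.1 m J : ℤ) := by
  obtain ⟨U, hU'⟩ := U
  replace hU : IsBeamAt m U := hU
  revert hU'
  refine IsBeamAt.induction (p := fun U => ∀ hU' : IsBeam U, beamClass ⟨U, hU'⟩ =
    classOfVec hA m fun J => (beamVec U m J : ℤ)) ?_ ?_ hU
  · intro _
    rw [beamClass_of_eq_empty rfl, beamVec_empty]
    exact (map_zero _).symm
  · intro U x hU hd ih hU'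
    have hvec : (fun J => (beamVec (U ∪ ray x m) m J : ℤ)) =
        (fun J => (beamVec U m J : ℤ)) + Pi.single (x m).tgt 1 := by
      ext J
      rw [beamVec_union hU (isBeamAt_ray x m) hd, beamVec_ray]
      simp [Pi.single_apply]
    have hb : IsBeam U := ⟨m, hU⟩
    rw [beamClass_union (U := ⟨U, hb⟩) (V := rayBeam x m) hd rfl, ih, hvec, map_add,
      classOfVec_single, beamClass_rayBeam hA]

theorem stateClass_eq (hA : Irred A) (m : ℤ) (J : Fin k) :
    stateClass hA m J = classOfVec hA (m + 1) fun I => (A J I : ℤ) := by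
  obtain ⟨x, rfl⟩ := hA.exists_point m J
  rw [← beamClass_rayBeam hA,
    beamClass_eq_classOfVec hA ((isBeamAt_ray x m).mono (by omega : m ≤ m + 1))]
  congr 1
  ext I
  exact congr_arg Nat.cast (beamVec_ray_succ hA x m I)

theorem classOfVec_add (hA : Irred A) (m : ℤ) (n : ℕ) (w : Fin k → ℤ) :
    classOfVec hA (m + n) (w ᵥ* A.map (Nat.cast : ℕ → ℤ) ^ n) = classOfVec hA m w := by
  induction n with
  | zero => simp
  | succ n ih =>
    have hstep (m : ℤ) : classOfVec hA (m + 1) ∘ₗ (A.map (Nat.cast : ℕ → ℤ)).vecMulLinear =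
        classOfVec hA m := by
      refine LinearMap.pi_ext' fun J => LinearMap.ext_ring ?_
      simp only [LinearMap.comp_apply, LinearMap.coe_single, Matrix.vecMulLinear_apply,
        Matrix.single_one_vecMul, classOfVec_single, stateClass_eq hA m J]
      rfl
    rw [← ih, ← hstep (m + n), pow_succ, ← Matrix.vecMul_vecMul, Nat.cast_succ, ← add_assoc]
    rfl

theorem exists_classOfVec_eq (hA : Irred A) (d : DimGroup A) :
    ∃ m w, classOfVec hA m w = d := by
  induction d using dimGroup_induction with
  | beam U =>
    obtain ⟨m, hU⟩ := U.2
    exact ⟨m, _, (beamClass_eq_classOfVec hA hU).symm⟩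
  | neg d hd =>
    obtain ⟨m, w, rfl⟩ := hd
    exact ⟨m, -w, map_neg _ w⟩
  | add d e hd he =>
    obtain ⟨m, w, rfl⟩ := hd
    obtain ⟨l, z, rfl⟩ := he
    obtain ⟨n, hn⟩ := Int.eq_ofNat_of_zero_le (sub_nonneg.2 (le_max_left m l))
    obtain ⟨p, hp⟩ := Int.eq_ofNat_of_zero_le (sub_nonneg.2 (le_max_right m l))
    have hmn : m + n = max m l := by omega
    have hlp : l + p = max m l := by omega
    refine ⟨max m l, w ᵥ* A.map (Nat.cast : ℕ → ℤ) ^ n + z ᵥ* A.map (Nat.cast : ℕ → ℤ) ^ p, ?_⟩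
    rw [map_add, ← classOfVec_add hA m n w, ← classOfVec_add hA l p z, hmn, hlp]

theorem dimGroup_hom_ext_stateClass (hA : Irred A) {G : Type*} [AddCommGroup G]
    {f g : DimGroup A →+ G} (h : ∀ m J, f (stateClass hA m J) = g (stateClass hA m J)) :
    f = g := by
  refine AddMonoidHom.ext fun d => ?_
  obtain ⟨m, w, rfl⟩ := exists_classOfVec_eq hA d
  simp only [classOfVec, Fintype.linearCombination_apply, map_sum, map_zsmul, h]

/-! ### The dimension triple -/

theorem coe_delta (x : matGroup A) :
    (delta A x : Fin k → ℚ) = (x : Fin k → ℚ) ᵥ* ratMat A := rfl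

theorem coe_delta_pow (n : ℕ) (x : matGroup A) :
    ((delta A ^ n) x : Fin k → ℚ) = (x : Fin k → ℚ) ᵥ* ratMat A ^ n := by
  induction n with
  | zero => simp
  | succ n ih =>
    rw [pow_succ', LinearEquiv.mul_apply, coe_delta, ih, Matrix.vecMul_vecMul, ← pow_succ]

theorem delta_zpow_delta_zpow (a b : ℤ) (x : matGroup A) :
    (delta A ^ a) ((delta A ^ b) x) = (delta A ^ (a + b)) x := by
  rw [zpow_add, LinearEquiv.mul_apply]

theorem intCast_vecMul_mem_matGroup (w : Fin k → ℤ) :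
    (fun i => (w i : ℚ)) ᵥ* ratMat A ^ k ∈ matGroup A :=
  ⟨⟨_, rfl⟩, 0, w ᵥ* A.map (Nat.cast : ℕ → ℤ) ^ k, by
    rw [int_vecMul, pow_zero, Matrix.vecMul_one]⟩

/-- The map `w ↦ w A^k` from `ℤ^k` to `𝒢_A`. -/
def matGroupOfVec (A : Matrix (Fin k) (Fin k) ℕ) : (Fin k → ℤ) →ₗ[ℤ] matGroup A :=
  AddMonoidHom.toIntLinearMap
    { toFun := fun w => ⟨(fun i => (w i : ℚ)) ᵥ* ratMat A ^ k, intCast_vecMul_mem_matGroup w⟩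
      map_zero' := Subtype.ext (by
        simp only [Pi.zero_apply, Int.cast_zero]
        exact Matrix.zero_vecMul _)
      map_add' := fun v w => Subtype.ext (by
        simp only [Pi.add_apply, Int.cast_add]
        exact Matrix.add_vecMul _ _ _) }

theorem coe_matGroupOfVec (w : Fin k → ℤ) :
    (matGroupOfVec A w : Fin k → ℚ) = (fun i => (w i : ℚ)) ᵥ* ratMat A ^ k := rfl

theorem theta_stateClass (hA : Irred A) (m : ℤ) (J : Fin k) :
    theta hA (stateClass hA m J) =
      (delta A ^ (-(k : ℤ) - m)) (matGroupOfVec A (Pi.single J 1)) := by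
  obtain ⟨x, rfl⟩ := hA.exists_point m J
  rw [← beamClass_rayBeam hA, theta_beamClass hA (rayBeam x m) (isBeamAt_ray x m)]
  refine congr_arg _ (Subtype.ext ?_)
  change beamVecQ (ray x m) m ᵥ* _ = _
  rw [coe_matGroupOfVec]
  congr 1
  ext I
  simp [beamVecQ, beamVec_ray, Pi.single_apply]

theorem theta_classOfVec (hA : Irred A) (m : ℤ) (w : Fin k → ℤ) :
    theta hA (classOfVec hA m w) = (delta A ^ (-(k : ℤ) - m)) (matGroupOfVec A w) := by
  have h : (theta hA).toIntLinearMap ∘ₗ classOfVec hA m =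
      (delta A ^ (-(k : ℤ) - m)).toLinearMap ∘ₗ matGroupOfVec A :=
    LinearMap.pi_ext' fun J => LinearMap.ext_ring (by
      simpa [classOfVec_single] using theta_stateClass hA m J)
  exact LinearMap.congr_fun h w

theorem theta_injective (hA : Irred A) : Function.Injective (theta hA) := by
  rw [injective_iff_map_eq_zero]
  intro d hd
  obtain ⟨m, w, rfl⟩ := exists_classOfVec_eq hA d
  rw [theta_classOfVec, LinearEquiv.map_eq_zero_iff] at hd
  have hw : w ᵥ* A.map (Nat.cast : ℕ → ℤ) ^ k = 0 := by
    have hwQ := coe_matGroupOfVec (A := A) w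
    rw [hd, int_vecMul] at hwQ
    ext i
    simpa using (congr_fun hwQ i).symm
  rw [← classOfVec_add hA m k, hw, map_zero]

theorem eq_theta_classOfVec (hA : Irred A) {g : matGroup A} {n : ℕ} {w : Fin k → ℤ}
    (hw : (g : Fin k → ℚ) ᵥ* ratMat A ^ n = fun i => (w i : ℚ)) :
    g = theta hA (classOfVec hA n w) := by
  have hg : matGroupOfVec A w = (delta A ^ ((k : ℤ) + n)) g := by
    refine Subtype.ext ?_
    rw [coe_matGroupOfVec, ← hw, add_comm, ← Nat.cast_add, zpow_natCast, coe_delta_pow, pow_add,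
      Matrix.vecMul_vecMul]
  rw [theta_classOfVec, hg, delta_zpow_delta_zpow, show -(k : ℤ) - n + (k + n) = 0 by ring,
    zpow_zero, LinearEquiv.coe_one, id_eq]

theorem theta_surjective (hA : Irred A) : Function.Surjective (theta hA) := by
  intro g
  obtain ⟨-, n, w, hw⟩ := g.2
  exact ⟨_, (eq_theta_classOfVec hA hw).symm⟩

/-- The isomorphism `θ`. -/
noncomputable def thetaEquiv (hA : Irred A) : DimGroup A ≃+ matGroup A :=
  AddEquiv.ofBijective (theta hA) ⟨theta_injective hA, theta_surjective hA⟩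

/-! ### The order on the dimension group -/

/-- The classes of beams, as a cone in `D_A`; it corresponds to `𝒢_A⁺` under `θ`. -/
def dimPos (A : Matrix (Fin k) (Fin k) ℕ) : AddSubmonoid (DimGroup A) :=
  AddSubmonoid.closure (range beamClass)

theorem natCast_vecMul (w : Fin k → ℕ) (n : ℕ) :
    (fun i => (w i : ℚ)) ᵥ* ratMat A ^ n = fun i => (((w ᵥ* A ^ n) i : ℕ) : ℚ) := by
  have hmap : ratMat A = A.map (Nat.castRingHom ℚ) := rfl
  rw [hmap, ← Matrix.map_pow]
  ext i
  simp [Matrix.vecMul, dotProduct]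

theorem zero_mem_matPos : (0 : matGroup A) ∈ matPos A := ⟨0, 0, by ext; simp⟩

theorem add_mem_matPos {x y : matGroup A} (hx : x ∈ matPos A) (hy : y ∈ matPos A) :
    x + y ∈ matPos A := by
  obtain ⟨n, w, hw⟩ := hx
  obtain ⟨p, z, hz⟩ := hy
  refine ⟨n + p, w ᵥ* A ^ p + z ᵥ* A ^ n, ?_⟩
  rw [AddSubgroup.coe_add, Matrix.add_vecMul, pow_add, ← Matrix.vecMul_vecMul, hw, natCast_vecMul,
    ← pow_add, add_comm n, pow_add, ← Matrix.vecMul_vecMul, hz, natCast_vecMul]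
  ext i
  simp

theorem delta_mem_matPos {x : matGroup A} : delta A x ∈ matPos A ↔ x ∈ matPos A := by
  constructor
  · rintro ⟨n, w, hw⟩
    exact ⟨n + 1, w, by rw [pow_succ', ← Matrix.vecMul_vecMul]; exact hw⟩
  · rintro ⟨n, w, hw⟩
    refine ⟨n, w ᵥ* A ^ 1, ?_⟩
    rw [← natCast_vecMul, pow_one, ← hw, coe_delta, Matrix.vecMul_vecMul, Matrix.vecMul_vecMul,
      ← pow_succ', ← pow_succ]

theorem delta_zpow_mem_matPos (z : ℤ) {x : matGroup A} :
    (delta A ^ z) x ∈ matPos A ↔ x ∈ matPos A := by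
  induction z using Int.induction_on with
  | zero => simp
  | succ n ih => rw [← ih, add_comm, zpow_one_add, LinearEquiv.mul_apply, delta_mem_matPos]
  | pred n ih =>
    rw [← ih, ← delta_mem_matPos, ← LinearEquiv.mul_apply, ← zpow_one_add, add_sub_cancel]

theorem theta_beamClass_mem_matPos (hA : Irred A) (U : Beam A) :
    theta hA (beamClass U) ∈ matPos A := by
  obtain ⟨m, hU⟩ := U.2
  rw [theta_beamClass hA U hU, delta_zpow_mem_matPos]
  exact ⟨0, beamVec U.1 m ᵥ* A ^ k, by
    rw [pow_zero, Matrix.vecMul_one, ← natCast_vecMul]; rfl⟩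

theorem theta_mem_matPos_iff (hA : Irred A) {d : DimGroup A} :
    theta hA d ∈ matPos A ↔ d ∈ dimPos A := by
  constructor
  · rintro ⟨n, w, hw⟩
    have hd : d = classOfVec hA n fun i => (w i : ℤ) :=
      theta_injective hA (eq_theta_classOfVec hA (by simpa using hw))
    rw [hd, classOfVec, Fintype.linearCombination_apply]
    refine sum_mem fun J _ => ?_
    have hJ : stateClass hA n J ∈ dimPos A := AddSubmonoid.subset_closure (mem_range_self _)
    rw [natCast_zsmul]
    exact nsmul_mem hJ _
  · intro hd
    induction hd using AddSubmonoid.closure_induction with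
    | mem d hd =>
      obtain ⟨U, rfl⟩ := hd
      exact theta_beamClass_mem_matPos hA U
    | zero => rw [map_zero]; exact zero_mem_matPos
    | add d e _ _ hd he => rw [map_add]; exact add_mem_matPos hd he

/-! ### The dimension representation -/

theorem Aut.dimMap_beamClass (φ : Aut A) (U : Beam A) :
    φ.dimMap (beamClass U) = beamClass (φ.mapBeam U) :=
  dimLift_beamClass _ _ _ U

/-- The inverse automorphism. -/
def Aut.inv (φ : Aut A) : Aut A :=
  ⟨φ.1.symm, fun x => by rw [Homeomorph.symm_apply_eq, φ.2, Homeomorph.apply_symm_apply]⟩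

theorem Aut.inv_apply_self (φ : Aut A) (x : Shift A) : φ.inv (φ x) = x :=
  φ.1.symm_apply_apply x

theorem Aut.apply_inv_self (φ : Aut A) (x : Shift A) : φ (φ.inv x) = x :=
  φ.1.apply_symm_apply x

theorem Aut.dimMap_inv_dimMap (φ : Aut A) (d : DimGroup A) : φ.inv.dimMap (φ.dimMap d) = d := by
  refine DFunLike.congr_fun (f := φ.inv.dimMap.comp φ.dimMap) (g := AddMonoidHom.id _)
    (dimGroup_hom_ext fun U => ?_) d
  simp only [AddMonoidHom.comp_apply, AddMonoidHom.id_apply, Aut.dimMap_beamClass]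
  refine congr_arg beamClass (Subtype.ext ?_)
  exact φ.1.toEquiv.symm_image_image U.1

/-- `φ_*` as an automorphism of `D_A`. -/
def Aut.dimEquiv (φ : Aut A) : DimGroup A ≃+ DimGroup A where
  toFun := φ.dimMap
  invFun := φ.inv.dimMap
  left_inv := φ.dimMap_inv_dimMap
  right_inv := φ.inv.dimMap_inv_dimMap
  map_add' := map_add φ.dimMap

theorem Aut.dimMap_mem_dimPos (φ : Aut A) {d : DimGroup A} (hd : d ∈ dimPos A) :
    φ.dimMap d ∈ dimPos A := by
  have hle : dimPos A ≤ (dimPos A).comap φ.dimMap := by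
    refine AddSubmonoid.closure_le.2 ?_
    rintro _ ⟨U, rfl⟩
    exact AddSubmonoid.subset_closure ⟨φ.mapBeam U, (φ.dimMap_beamClass U).symm⟩
  exact hle hd

theorem Aut.dimMap_mem_dimPos_iff (φ : Aut A) {d : DimGroup A} :
    φ.dimMap d ∈ dimPos A ↔ d ∈ dimPos A :=
  ⟨fun hd => φ.dimMap_inv_dimMap d ▸ φ.inv.dimMap_mem_dimPos hd, φ.dimMap_mem_dimPos⟩

/-- The shift, as an automorphism of the edge shift. -/
def shiftAut (A : Matrix (Fin k) (Fin k) ℕ) : Aut A := ⟨shift A, fun _ => rfl⟩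

theorem image_shift_ray (x : Shift A) (m : ℤ) :
    shift A '' ray x (m + 1) = ray (shift A x) m := by
  ext z
  constructor
  · rintro ⟨w, hw, rfl⟩ i hi
    exact hw (i + 1) (by omega)
  · intro hz
    refine ⟨(shift A).symm z, fun i hi => ?_, (shift A).apply_symm_apply z⟩
    have hzi : z (i - 1) = x (i - 1 + 1) := hz (i - 1) (by omega)
    rwa [sub_add_cancel] at hzi

theorem dimMap_shiftAut_stateClass (hA : Irred A) (m : ℤ) (J : Fin k) :
    (shiftAut A).dimMap (stateClass hA (m + 1) J) = stateClass hA m J := by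
  obtain ⟨x, rfl⟩ := hA.exists_point (m + 1) J
  rw [← beamClass_rayBeam hA, Aut.dimMap_beamClass]
  change _ = stateClass hA m (shift A x m).tgt
  rw [← beamClass_rayBeam hA]
  exact congr_arg beamClass (Subtype.ext (image_shift_ray x m))

theorem theta_dimMap_shiftAut (hA : Irred A) (d : DimGroup A) :
    theta hA ((shiftAut A).dimMap d) = delta A (theta hA d) := by
  refine DFunLike.congr_fun (f := (theta hA).comp (shiftAut A).dimMap)
    (g := (delta A).toAddEquiv.toAddMonoidHom.comp (theta hA))
    (dimGroup_hom_ext_stateClass hA fun m J => ?_) d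
  obtain ⟨m, rfl⟩ : ∃ l, m = l + 1 := ⟨m - 1, by omega⟩
  change theta hA ((shiftAut A).dimMap (stateClass hA (m + 1) J)) =
    delta A (theta hA (stateClass hA (m + 1) J))
  rw [dimMap_shiftAut_stateClass, theta_stateClass, theta_stateClass, ← LinearEquiv.mul_apply,
    ← zpow_one_add]
  congr 2
  ring

theorem Aut.dimMap_shiftAut_comm (φ : Aut A) (d : DimGroup A) :
    φ.dimMap ((shiftAut A).dimMap d) = (shiftAut A).dimMap (φ.dimMap d) := by
  refine DFunLike.congr_fun (f := φ.dimMap.comp (shiftAut A).dimMap)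
    (g := (shiftAut A).dimMap.comp φ.dimMap) (dimGroup_hom_ext fun U => ?_) d
  simp only [AddMonoidHom.comp_apply, Aut.dimMap_beamClass]
  refine congr_arg beamClass (Subtype.ext ?_)
  change φ '' (shift A '' U.1) = shift A '' (φ '' U.1)
  rw [image_image, image_image]
  exact image_congr fun x _ => φ.2 x

/-- The automorphism `S_φ = θ φ_* θ⁻¹` of `𝒢_A`. -/
noncomputable def dimRep (hA : Irred A) (φ : Aut A) : MatAut A :=
  (((thetaEquiv hA).symm.trans φ.dimEquiv).trans (thetaEquiv hA)).toIntLinearEquiv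

theorem dimRep_theta (hA : Irred A) (φ : Aut A) (d : DimGroup A) :
    dimRep hA φ (theta hA d) = theta hA (φ.dimMap d) :=
  congr_arg (fun d => theta hA (φ.dimMap d)) ((thetaEquiv hA).symm_apply_apply d)

theorem isDimRep_dimRep (hA : Irred A) (φ : Aut A) : IsDimRep hA φ (dimRep hA φ) where
  comm := dimRep_theta hA φ
  pos g := by
    obtain ⟨d, rfl⟩ := theta_surjective hA g
    rw [dimRep_theta, theta_mem_matPos_iff, theta_mem_matPos_iff, φ.dimMap_mem_dimPos_iff]
  comm_delta g := by
    obtain ⟨d, rfl⟩ := theta_surjective hA g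
    rw [← theta_dimMap_shiftAut, dimRep_theta, dimRep_theta, ← theta_dimMap_shiftAut,
      φ.dimMap_shiftAut_comm]

theorem IsDimRep.unique {hA : Irred A} {φ : Aut A} {S T : MatAut A} (hS : IsDimRep hA φ S)
    (hT : IsDimRep hA φ T) : S = T := by
  refine LinearEquiv.ext fun g => ?_
  obtain ⟨d, rfl⟩ := theta_surjective hA g
  rw [hS.comm, hT.comm]

/-! ### States -/

/-- The pairing of `𝒢_A` with a column vector `v`. -/
noncomputable def pairing (A : Matrix (Fin k) (Fin k) ℕ) (v : Fin k → ℝ) : matGroup A →+ ℝ where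
  toFun x := (fun i => ((x : Fin k → ℚ) i : ℝ)) ⬝ᵥ v
  map_zero' := by simp [dotProduct]
  map_add' x y := by simp [dotProduct, add_mul, Finset.sum_add_distrib]

theorem pairing_apply (v : Fin k → ℝ) (x : matGroup A) :
    pairing A v x = (fun i => ((x : Fin k → ℚ) i : ℝ)) ⬝ᵥ v := rfl

theorem ratCast_vecMul_ratMat_pow {K : Type*} [Field K] [CharZero K] (x : Fin k → ℚ) (n : ℕ) :
    (fun i => (((x ᵥ* ratMat A ^ n) i : ℚ) : K)) =
      (fun i => (x i : K)) ᵥ* A.map (Nat.cast : ℕ → K) ^ n := by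
  have hmap : A.map (Nat.cast : ℕ → K) = (ratMat A).map (Rat.castHom K) := by
    ext i j
    simp
  rw [hmap, ← Matrix.map_pow]
  ext i
  simp [Matrix.vecMul, dotProduct]

theorem pairing_delta {v : Fin k → ℝ} (hv : A.map (Nat.cast : ℕ → ℝ) *ᵥ v = perron A • v)
    (x : matGroup A) : pairing A v (delta A x) = perron A * pairing A v x := by
  have hx := ratCast_vecMul_ratMat_pow (A := A) (K := ℝ) (x : Fin k → ℚ) 1
  rw [pow_one, pow_one] at hx
  rw [pairing_apply, coe_delta, hx, ← Matrix.dotProduct_mulVec, hv, dotProduct_smul, smul_eq_mul,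
    pairing_apply]

theorem pairing_matGroupOfVec_single {v : Fin k → ℝ}
    (hv : A.map (Nat.cast : ℕ → ℝ) *ᵥ v = perron A • v) (J : Fin k) :
    pairing A v (matGroupOfVec A (Pi.single J 1)) = perron A ^ k * v J := by
  have hJ : (fun i => (((Pi.single J 1 : Fin k → ℤ) i : ℚ) : ℝ)) = Pi.single J 1 := by
    ext i
    simp [Pi.single_apply, apply_ite]
  rw [pairing_apply, coe_matGroupOfVec, ratCast_vecMul_ratMat_pow, hJ, ← Matrix.dotProduct_mulVec,
    PerronFrobenius.pow_mulVec_eq_smul hv, single_one_dotProduct, Pi.smul_apply, smul_eq_mul]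

/-- The homomorphism `D_A → ℝ` given by pairing `θ` with a right eigenvector `v` of `A`. If `v` is
a positive eigenvector for `λ_A`, this is the state of the canonical measures given by `v`. -/
noncomputable def perronState (hA : Irred A) (v : Fin k → ℝ) : DimGroup A →+ ℝ :=
  (pairing A v).comp (theta hA)

theorem perronState_apply (hA : Irred A) (v : Fin k → ℝ) (d : DimGroup A) :
    perronState hA v d = pairing A v (theta hA d) := rfl

theorem perronState_dimMap_shiftAut (hA : Irred A) {v : Fin k → ℝ}
    (hv : A.map (Nat.cast : ℕ → ℝ) *ᵥ v = perron A • v) (d : DimGroup A) :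
    perronState hA v ((shiftAut A).dimMap d) = perron A * perronState hA v d := by
  rw [perronState_apply, theta_dimMap_shiftAut, pairing_delta hv, perronState_apply]

theorem perronState_smul (hA : Irred A) (t : ℝ) (v : Fin k → ℝ) (d : DimGroup A) :
    perronState hA (t • v) d = t * perronState hA v d := by
  simp only [perronState_apply, pairing_apply, dotProduct_smul, smul_eq_mul]

theorem map_stateClass_of_dimMap_shiftAut [Nonempty (Fin k)] (hA : Irred A)
    {τ : DimGroup A →+ ℝ} (hτ : ∀ d, τ ((shiftAut A).dimMap d) = perron A * τ d) (m : ℤ)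
    (J : Fin k) : τ (stateClass hA m J) = perron A ^ (-m) * τ (stateClass hA 0 J) := by
  have hpos := hA.perron_pos.ne'
  have hstep (m : ℤ) : τ (stateClass hA m J) = perron A * τ (stateClass hA (m + 1) J) := by
    rw [← dimMap_shiftAut_stateClass, hτ]
  induction m using Int.induction_on with
  | zero => simp
  | succ n ih =>
    refine mul_left_cancel₀ hpos ?_
    rw [← hstep, ih, ← mul_assoc, ← zpow_one_add₀ hpos]
    congr 2
    ring
  | pred n ih =>
    rw [hstep, sub_add_cancel, ih, ← mul_assoc, ← zpow_one_add₀ hpos]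
    congr 2
    ring

theorem mulVec_map_stateClass (hA : Irred A) {τ : DimGroup A →+ ℝ}
    (hτ : ∀ d, τ ((shiftAut A).dimMap d) = perron A * τ d) :
    (A.map (Nat.cast : ℕ → ℝ) *ᵥ fun J => τ (stateClass hA 0 J)) =
      perron A • fun J => τ (stateClass hA 0 J) := by
  ext J
  have hJ : (shiftAut A).dimMap (stateClass hA 0 J) = classOfVec hA 0 fun I => (A J I : ℤ) := by
    rw [stateClass_eq, classOfVec, classOfVec, Fintype.linearCombination_apply,
      Fintype.linearCombination_apply, map_sum]
    simp only [map_zsmul, dimMap_shiftAut_stateClass]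
  rw [Pi.smul_apply, smul_eq_mul, ← hτ, hJ, classOfVec, Fintype.linearCombination_apply, map_sum]
  simp [Matrix.mulVec, dotProduct]

section

variable [Nonempty (Fin k)]

theorem perronState_stateClass (hA : Irred A) {v : Fin k → ℝ}
    (hv : A.map (Nat.cast : ℕ → ℝ) *ᵥ v = perron A • v) (m : ℤ) (J : Fin k) :
    perronState hA v (stateClass hA m J) = perron A ^ (-m) * v J := by
  have hscale := map_stateClass_of_dimMap_shiftAut hA (perronState_dimMap_shiftAut hA hv)
  have hk : perronState hA v (stateClass hA (-k) J) = perron A ^ k * v J := by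
    rw [perronState_apply, theta_stateClass, sub_self, zpow_zero, LinearEquiv.coe_one, id_eq,
      pairing_matGroupOfVec_single hv]
  rw [hscale, neg_neg, zpow_natCast] at hk
  rw [hscale, mul_left_cancel₀ (pow_pos hA.perron_pos k).ne' hk]

theorem exists_eq_perronState (hA : Irred A) {τ : DimGroup A →+ ℝ}
    (hτ : ∀ d, τ ((shiftAut A).dimMap d) = perron A * τ d) :
    ∃ v, A.map (Nat.cast : ℕ → ℝ) *ᵥ v = perron A • v ∧ τ = perronState hA v := by
  have hv := mulVec_map_stateClass hA hτ
  refine ⟨_, hv, dimGroup_hom_ext_stateClass hA fun m J => ?_⟩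
  rw [perronState_stateClass hA hv, map_stateClass_of_dimMap_shiftAut hA hτ]

/-- `v` is a positive right eigenvector of `A` for the Perron–Frobenius eigenvalue `λ_A`. -/
structure IsPerronVec (A : Matrix (Fin k) (Fin k) ℕ) (v : Fin k → ℝ) : Prop where
  pos : ∀ i, 0 < v i
  mulVec : A.map (Nat.cast : ℕ → ℝ) *ᵥ v = perron A • v

theorem Irred.exists_isPerronVec (hA : Irred A) : ∃ v, IsPerronVec A v :=
  let ⟨_, v, _, hv, _, hAv⟩ := hA.exists_perron_eigenvectors
  ⟨v, hv, hAv⟩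

theorem IsPerronVec.perronState_rayBeam {v : Fin k → ℝ} (hv : IsPerronVec A v) (hA : Irred A)
    (x : Shift A) (m : ℤ) :
    perronState hA v (beamClass (rayBeam x m)) = perron A ^ (-m) * v (x m).tgt := by
  rw [beamClass_rayBeam hA, perronState_stateClass hA hv.mulVec]

theorem IsPerronVec.perronState_rayBeam_pos {v : Fin k → ℝ} (hv : IsPerronVec A v) (hA : Irred A)
    (x : Shift A) (m : ℤ) : 0 < perronState hA v (beamClass (rayBeam x m)) := by
  rw [hv.perronState_rayBeam hA]
  exact mul_pos (zpow_pos hA.perron_pos _) (hv.pos _)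

theorem IsPerronVec.perronState_nonneg {v : Fin k → ℝ} (hv : IsPerronVec A v) (hA : Irred A)
    (U : Beam A) : 0 ≤ perronState hA v (beamClass U) := by
  obtain ⟨m, hU⟩ := U.2
  rw [beamClass_eq_classOfVec hA hU, classOfVec, Fintype.linearCombination_apply, map_sum]
  refine Finset.sum_nonneg fun J _ => ?_
  rw [map_zsmul, perronState_stateClass hA hv.mulVec]
  have hJ := (hv.pos J).le
  have hperron := hA.perron_pos
  positivity

/-! ### The scaling factor of an automorphism -/

theorem exists_perronState_dimMap_eq (hA : Irred A) (φ : Aut A) :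
    ∃ c : ℝ, ∀ v, A.map (Nat.cast : ℕ → ℝ) *ᵥ v = perron A • v →
      ∀ d, perronState hA v (φ.dimMap d) = c * perronState hA v d := by
  obtain ⟨v₀, hv₀⟩ := hA.exists_isPerronVec
  obtain ⟨w, hw, hφw⟩ := exists_eq_perronState hA
    (τ := (perronState hA v₀).comp φ.dimMap) fun d => by
      rw [AddMonoidHom.comp_apply, φ.dimMap_shiftAut_comm,
        perronState_dimMap_shiftAut hA hv₀.mulVec, AddMonoidHom.comp_apply]
  obtain ⟨c, rfl⟩ := PerronFrobenius.eigenvector_unique hA hv₀.pos hv₀.mulVec hw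
  refine ⟨c, fun v hv d => ?_⟩
  obtain ⟨t, rfl⟩ := PerronFrobenius.eigenvector_unique hA hv₀.pos hv₀.mulVec hv
  have hφd : perronState hA v₀ (φ.dimMap d) = c * perronState hA v₀ d :=
    (DFunLike.congr_fun hφw d).trans (perronState_smul hA c v₀ d)
  rw [perronState_smul, perronState_smul, hφd, mul_left_comm]

/-- The factor `λ_φ` by which `φ_*` multiplies the states of canonical measures. -/
noncomputable def scale (hA : Irred A) (φ : Aut A) : ℝ :=
  (exists_perronState_dimMap_eq hA φ).choose

theorem perronState_dimMap (hA : Irred A) (φ : Aut A) {v : Fin k → ℝ}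
    (hv : A.map (Nat.cast : ℕ → ℝ) *ᵥ v = perron A • v) (d : DimGroup A) :
    perronState hA v (φ.dimMap d) = scale hA φ * perronState hA v d :=
  (exists_perronState_dimMap_eq hA φ).choose_spec v hv d

theorem IsPerronVec.eq_scale {v : Fin k → ℝ} (hv : IsPerronVec A v) (hA : Irred A) {φ : Aut A}
    {c : ℝ} (hc : ∀ d, perronState hA v (φ.dimMap d) = c * perronState hA v d) :
    c = scale hA φ := by
  obtain ⟨x, -⟩ := hA.exists_point 0 (Classical.arbitrary _)
  refine mul_right_cancel₀ (hv.perronState_rayBeam_pos hA x 0).ne' ?_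
  rw [← hc, perronState_dimMap hA φ hv.mulVec]

theorem scale_inv_mul_scale (hA : Irred A) (φ : Aut A) : scale hA φ.inv * scale hA φ = 1 := by
  obtain ⟨v, hv⟩ := hA.exists_isPerronVec
  obtain ⟨x, -⟩ := hA.exists_point 0 (Classical.arbitrary _)
  refine mul_right_cancel₀ (hv.perronState_rayBeam_pos hA x 0).ne' ?_
  rw [mul_assoc, ← perronState_dimMap hA φ hv.mulVec, ← perronState_dimMap hA φ.inv hv.mulVec,
    φ.dimMap_inv_dimMap, one_mul]

theorem scale_inv (hA : Irred A) (φ : Aut A) : scale hA φ.inv = (scale hA φ)⁻¹ :=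
  eq_inv_of_mul_eq_one_left (scale_inv_mul_scale hA φ)

theorem scale_pos (hA : Irred A) (φ : Aut A) : 0 < scale hA φ := by
  obtain ⟨v, hv⟩ := hA.exists_isPerronVec
  obtain ⟨x, -⟩ := hA.exists_point 0 (Classical.arbitrary _)
  have hφx := hv.perronState_nonneg hA (φ.mapBeam (rayBeam x 0))
  rw [← φ.dimMap_beamClass, perronState_dimMap hA φ hv.mulVec] at hφx
  exact (nonneg_of_mul_nonneg_left hφx (hv.perronState_rayBeam_pos hA x 0)).lt_of_ne'
    (right_ne_zero_of_mul_eq_one (scale_inv_mul_scale hA φ))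

end

theorem IsState.unique (hA : Irred A) {μ : ∀ x : Shift A, Measure (Unstable x)}
    {τ τ' : DimGroup A →+ ℝ} (h : IsState μ τ) (h' : IsState μ τ') : τ = τ' :=
  dimGroup_hom_ext_stateClass hA fun m J => by
    obtain ⟨x, rfl⟩ := hA.exists_point m J
    rw [← beamClass_rayBeam hA, h.ray, h'.ray]

theorem IsPerronVec.isState_perronState [Nonempty (Fin k)] {v : Fin k → ℝ} (hv : IsPerronVec A v)
    (hA : Irred A) {μ : ∀ x : Shift A, Measure (Unstable x)}
    (hμ : ∀ (x : Shift A) (y : Unstable x) (m : ℤ),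
      μ x (unstableRay x y.pt m) = ENNReal.ofReal (perron A ^ (-m) * v (y.pt m).tgt)) :
    IsState μ (perronState hA v) where
  nonneg := hv.perronState_nonneg hA
  ray x n := by
    rw [hμ x ⟨x, mem_iUnion.2 ⟨0, self_mem_ray x 0⟩⟩ n, ← hv.perronState_rayBeam hA,
      ENNReal.toReal_ofReal (hv.perronState_nonneg hA _)]

theorem IsUnstableMeasureFamily.existsUnique_isState [Nonempty (Fin k)] (hA : Irred A)
    {μ : ∀ x : Shift A, Measure (Unstable x)} (hμ : IsUnstableMeasureFamily μ) :
    ∃! τ : DimGroup A →+ ℝ, IsState μ τ := by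
  obtain ⟨v, hpos, hv, hray⟩ := hμ
  have hτ := IsPerronVec.isState_perronState ⟨hpos, hv⟩ hA hray
  exact ⟨_, hτ, fun τ h => h.unique hA hτ⟩

/-! ### The complexified dimension group -/

/-- The coordinatewise embedding `ℚ^k → ℂ^k`. -/
noncomputable def ratCastVec (k : ℕ) : (Fin k → ℚ) →ₗ[ℤ] (Fin k → ℂ) :=
  ((Rat.castHom ℂ).toAddMonoidHom.compLeft (Fin k)).toIntLinearMap

theorem ratCastVec_apply (x : Fin k → ℚ) (i : Fin k) : ratCastVec k x i = (x i : ℂ) := rfl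

theorem liftBaseChange_ratCastVec_injective (k : ℕ) :
    Function.Injective ((ratCastVec k).liftBaseChange ℂ) := by
  let inv : (Fin k → ℂ) →ₗ[ℂ] ℂ ⊗[ℤ] (Fin k → ℚ) :=
    Fintype.linearCombination ℂ fun i => (1 : ℂ) ⊗ₜ Pi.single i (1 : ℚ)
  have inv_apply (w) : inv w = ∑ i, w i ⊗ₜ Pi.single i (1 : ℚ) := by
    simp [inv, Fintype.linearCombination_apply, TensorProduct.smul_tmul']
  refine Function.LeftInverse.injective (g := inv) fun t => ?_
  induction t with
  | zero => simp only [map_zero]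
  | add a b ha hb => rw [map_add, map_add, ha, hb]
  | tmul c q =>
    have hterm (i : Fin k) : (c * (q i : ℂ)) ⊗ₜ[ℤ] (Pi.single i 1 : Fin k → ℚ) =
        c ⊗ₜ[ℤ] (Pi.single i (q i) : Fin k → ℚ) := by
      rw [mul_comm, ← Rat.smul_def, TensorProduct.smul_tmul, ← Pi.single_smul, smul_eq_mul, mul_one]
    simp only [LinearMap.liftBaseChange_tmul, inv_apply, Pi.smul_apply, ratCastVec_apply,
      smul_eq_mul, hterm, ← TensorProduct.tmul_sum, Finset.univ_sum_single]

/-- The inclusion `𝒢_A ⊗ ℂ → ℂ^k`. -/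
noncomputable def toComplexVec (A : Matrix (Fin k) (Fin k) ℕ) :
    (ℂ ⊗[ℤ] matGroup A) →ₗ[ℂ] (Fin k → ℂ) :=
  ((ratCastVec k).comp (matGroup A).subtype.toIntLinearMap).liftBaseChange ℂ

theorem toComplexVec_tmul (c : ℂ) (x : matGroup A) :
    toComplexVec A (c ⊗ₜ x) = c • fun i => ((x : Fin k → ℚ) i : ℂ) :=
  LinearMap.liftBaseChange_tmul ..

theorem toComplexVec_injective (A : Matrix (Fin k) (Fin k) ℕ) :
    Function.Injective (toComplexVec A) := by
  have hcomp (t) : toComplexVec A t = (ratCastVec k).liftBaseChange ℂ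
      ((matGroup A).subtype.toIntLinearMap.lTensor ℂ t) := by
    induction t with
    | zero => simp only [map_zero]
    | add a b ha hb => simp only [map_add, ha, hb]
    | tmul c x =>
      rw [LinearMap.lTensor_tmul, LinearMap.liftBaseChange_tmul, toComplexVec_tmul]
      rfl
  intro s t hst
  rw [hcomp, hcomp] at hst
  exact Module.Flat.lTensor_preserves_injective_linearMap (M := ℂ)
    (matGroup A).subtype.toIntLinearMap Subtype.val_injective
    (liftBaseChange_ratCastVec_injective k hst)

theorem complexify_tmul (S : MatAut A) (c : ℂ) (x : matGroup A) :
    complexify S (c ⊗ₜ x) = c ⊗ₜ S x := rfl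

theorem toComplexVec_delta (t : ℂ ⊗[ℤ] matGroup A) :
    toComplexVec A (complexify (delta A) t) = toComplexVec A t ᵥ* A.map (Nat.cast : ℕ → ℂ) := by
  induction t with
  | zero => simp only [map_zero, Matrix.zero_vecMul]
  | add a b ha hb => simp only [map_add, Matrix.add_vecMul, ha, hb]
  | tmul c x =>
    have hx := ratCast_vecMul_ratMat_pow (A := A) (K := ℂ) (x : Fin k → ℚ) 1
    rw [pow_one, pow_one] at hx
    rw [complexify_tmul, toComplexVec_tmul, toComplexVec_tmul, Matrix.smul_vecMul, coe_delta, hx]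

theorem exists_toComplexVec_eq (A : Matrix (Fin k) (Fin k) ℕ) (w : Fin k → ℂ) :
    ∃ t, toComplexVec A t = w ᵥ* A.map (Nat.cast : ℕ → ℂ) ^ k := by
  refine ⟨∑ j, w j ⊗ₜ matGroupOfVec A (Pi.single j 1), ?_⟩
  have hj (j : Fin k) : (fun i => ((matGroupOfVec A (Pi.single j 1) : Fin k → ℚ) i : ℂ)) =
      Pi.single j 1 ᵥ* A.map (Nat.cast : ℕ → ℂ) ^ k := by
    rw [coe_matGroupOfVec, ratCast_vecMul_ratMat_pow]
    congr 1
    ext i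
    simp [Pi.single_apply, apply_ite]
  simp only [map_sum, toComplexVec_tmul, hj, ← Matrix.smul_vecMul, ← Matrix.sum_vecMul]
  congr 1
  ext i
  simp [Finset.sum_apply, Pi.single_apply]

theorem dotProduct_toComplexVec_complexify {v : Fin k → ℝ} {S : MatAut A} {c : ℝ}
    (hS : ∀ x, pairing A v (S x) = c * pairing A v x) (t : ℂ ⊗[ℤ] matGroup A) :
    toComplexVec A (complexify S t) ⬝ᵥ (fun i => (v i : ℂ)) =
      c * (toComplexVec A t ⬝ᵥ fun i => (v i : ℂ)) := by
  have hpairing (x : matGroup A) :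
      (fun i => ((x : Fin k → ℚ) i : ℂ)) ⬝ᵥ (fun i => (v i : ℂ)) = (pairing A v x : ℂ) := by
    simp [pairing_apply, dotProduct]
  induction t with
  | zero => simp
  | add a b ha hb => simp only [map_add, add_dotProduct, ha, hb, mul_add]
  | tmul z x =>
    rw [complexify_tmul, toComplexVec_tmul, toComplexVec_tmul, smul_dotProduct, smul_dotProduct,
      hpairing, hpairing, hS, smul_eq_mul, smul_eq_mul, Complex.ofReal_mul, mul_left_comm]

section

variable [Nonempty (Fin k)]

theorem Irred.exists_toComplexVec_eq_of_eigenvector (hA : Irred A) {w : Fin k → ℂ}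
    (hw : w ᵥ* A.map (Nat.cast : ℕ → ℂ) = (perron A : ℂ) • w) : ∃ t, toComplexVec A t = w := by
  obtain ⟨t, ht⟩ := exists_toComplexVec_eq A w
  have hpow : w ᵥ* A.map (Nat.cast : ℕ → ℂ) ^ k = (perron A : ℂ) ^ k • w := by
    rw [← Matrix.mulVec_transpose] at hw ⊢
    rw [Matrix.transpose_pow, PerronFrobenius.pow_mulVec_eq_smul hw]
  have hne : (perron A : ℂ) ^ k ≠ 0 := pow_ne_zero k (Complex.ofReal_ne_zero.2 hA.perron_pos.ne')
  exact ⟨((perron A : ℂ) ^ k)⁻¹ • t, by rw [map_smul, ht, hpow, inv_smul_smul₀ hne]⟩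

theorem Irred.exists_pos_complex_eigenvector (hA : Irred A) :
    ∃ (u : Fin k → ℝ) (t : ℂ ⊗[ℤ] matGroup A), (∀ i, 0 < u i) ∧
      toComplexVec A t = (fun i => (u i : ℂ)) ∧
      complexify (delta A) t = (perron A : ℂ) • t ∧
      ∀ s, complexify (delta A) s = (perron A : ℂ) • s → ∃ c : ℂ, s = c • t := by
  obtain ⟨u, -, hu, -, huA, -⟩ := hA.exists_perron_eigenvectors
  have huC : (fun i => (u i : ℂ)) ᵥ* A.map (Nat.cast : ℕ → ℂ) =
      (perron A : ℂ) • fun i => (u i : ℂ) := by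
    ext i
    simpa [Matrix.vecMul, dotProduct] using congr_arg ((↑) : ℝ → ℂ) (congr_fun huA i)
  obtain ⟨t, ht⟩ := hA.exists_toComplexVec_eq_of_eigenvector huC
  refine ⟨u, t, hu, ht, toComplexVec_injective A ?_, fun s hs => ?_⟩
  · rw [toComplexVec_delta, ht, huC, map_smul, ht]
  · obtain ⟨c, hc⟩ := hA.left_eigenvector_unique hu huA (w := toComplexVec A s) (by
      rw [← toComplexVec_delta, hs, map_smul])
    exact ⟨c, toComplexVec_injective A (by rw [hc, map_smul, ht])⟩

theorem toComplexVec_pos_ne_zero {t : ℂ ⊗[ℤ] matGroup A} {u : Fin k → ℝ} (hu : ∀ i, 0 < u i)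
    (ht : toComplexVec A t = fun i => (u i : ℂ)) : t ≠ 0 := by
  rintro rfl
  rw [map_zero] at ht
  exact (hu (Classical.arbitrary _)).ne' (by simpa using (congr_fun ht _).symm)

theorem Irred.exists_complexify_delta_eq (hA : Irred A) :
    ∃ t : ℂ ⊗[ℤ] matGroup A, t ≠ 0 ∧ complexify (delta A) t = (perron A : ℂ) • t :=
  let ⟨_, t, hu, ht, heig, _⟩ := hA.exists_pos_complex_eigenvector
  ⟨t, toComplexVec_pos_ne_zero hu ht, heig⟩

theorem pairing_dimRep (hA : Irred A) (φ : Aut A) {v : Fin k → ℝ}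
    (hv : A.map (Nat.cast : ℕ → ℝ) *ᵥ v = perron A • v) (x : matGroup A) :
    pairing A v (dimRep hA φ x) = scale hA φ * pairing A v x := by
  obtain ⟨d, rfl⟩ := theta_surjective hA x
  rw [dimRep_theta, ← perronState_apply, perronState_dimMap hA φ hv, perronState_apply]

theorem complexify_dimRep_of_eigenvector (hA : Irred A) (φ : Aut A) {t : ℂ ⊗[ℤ] matGroup A}
    (ht : complexify (delta A) t = (perron A : ℂ) • t) :
    complexify (dimRep hA φ) t = (scale hA φ : ℂ) • t := by
  obtain ⟨u, s, hu, hs, heig, hspan⟩ := hA.exists_pos_complex_eigenvector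
  obtain ⟨v, hv⟩ := hA.exists_isPerronVec
  have hcomm (r) : complexify (delta A) (complexify (dimRep hA φ) r) =
      complexify (dimRep hA φ) (complexify (delta A) r) := by
    induction r with
    | zero => simp only [map_zero]
    | add a b ha hb => simp only [map_add, ha, hb]
    | tmul z x => simp only [complexify_tmul, (isDimRep_dimRep hA φ).comm_delta]
  obtain ⟨c, hc⟩ := hspan _ ((hcomm s).trans (by rw [heig, map_smul]))
  have hpair := dotProduct_toComplexVec_complexify (pairing_dimRep hA φ hv.mulVec) s
  have huv : (fun i => (u i : ℂ)) ⬝ᵥ (fun i => (v i : ℂ)) ≠ 0 := by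
    have hreal : u ⬝ᵥ v ≠ 0 := (Finset.sum_pos (fun i _ => mul_pos (hu i) (hv.pos i))
      Finset.univ_nonempty).ne'
    simpa [dotProduct] using Complex.ofReal_ne_zero.2 hreal
  rw [hc, map_smul, hs, smul_dotProduct, smul_eq_mul] at hpair
  obtain ⟨a, rfl⟩ := hspan t ht
  rw [map_smul, hc, mul_right_cancel₀ huv hpair, smul_comm]

theorem isPerronEigenvalue_iff (hA : Irred A) (φ : Aut A) (c : ℂ) :
    IsPerronEigenvalue hA φ c ↔ c = scale hA φ := by
  constructor
  · intro hc
    obtain ⟨t, ht0, ht⟩ := hA.exists_complexify_delta_eq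
    refine smul_left_injective ℂ ht0 ?_
    exact (hc _ (isDimRep_dimRep hA φ) t ht).symm.trans (complexify_dimRep_of_eigenvector hA φ ht)
  · rintro rfl S hS t ht
    rw [hS.unique (isDimRep_dimRep hA φ)]
    exact complexify_dimRep_of_eigenvector hA φ ht

end

/-! ### The topology of unstable sets -/

theorem Unstable.pt_injective {x : Shift A} : Function.Injective (Unstable.pt (x := x)) := by
  rintro ⟨y, hy⟩ ⟨z, hz⟩ rfl
  rfl

/-- The point `x` of `W^u(x)`. -/
def Unstable.base (x : Shift A) : Unstable x := ⟨x, mem_iUnion.2 ⟨0, self_mem_ray x 0⟩⟩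

theorem ray_subset_range_pt {x : Shift A} (y : Unstable x) (m : ℤ) :
    ray y.pt m ⊆ range (Unstable.pt (x := x)) := by
  intro z hz
  obtain ⟨n, hn⟩ := mem_iUnion.1 y.mem
  refine ⟨⟨z, mem_iUnion.2 ⟨min m n, fun i hi => ?_⟩⟩, rfl⟩
  rw [hz i (hi.trans (min_le_left _ _)), hn i (hi.trans (min_le_right _ _))]

theorem image_unstableRay {x : Shift A} (y : Unstable x) (m : ℤ) :
    Unstable.pt '' unstableRay x y.pt m = ray y.pt m :=
  image_preimage_eq_of_subset (ray_subset_range_pt y m)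

theorem isOpen_unstableRay (x y : Shift A) (m : ℤ) : IsOpen (unstableRay x y m) := by
  rcases eq_empty_or_nonempty (unstableRay x y m) with h | ⟨z, hz⟩
  · rw [h]
    exact isOpen_empty
  · refine TopologicalSpace.isOpen_generateFrom_of_mem ⟨z, m, ?_⟩
    ext w
    rw [unstableRay, ← ray_eq_of_mem hz]
    rfl

theorem preimage_biUnion_ray (x : Shift A) (s : Set (Shift A)) (m : ℤ) :
    Unstable.pt ⁻¹' (⋃ y ∈ s, ray y m) = ⋃ y ∈ s, unstableRay x y m := by
  simp only [preimage_iUnion]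
  rfl

theorem IsBeam.isOpen_preimage {U : Set (Shift A)} (hU : IsBeam U) (x : Shift A) :
    IsOpen (Unstable.pt (x := x) ⁻¹' U) := by
  obtain ⟨m, s, -, rfl⟩ := hU
  rw [preimage_biUnion_ray]
  exact isOpen_biUnion fun y _ => isOpen_unstableRay x y m

theorem isClosed_ray (y : Shift A) (m : ℤ) : IsClosed (ray y m) := by
  simp only [ray, ofPred_forall]
  exact isClosed_iInter fun i => isClosed_iInter fun _ =>
    isClosed_eq (Shift.continuous_apply i) continuous_const

-- Inside an `m`-ray only the coordinates in `(m, n]` decide membership in an `n`-ray.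
theorem isOpen_preimage_val_ray (y w : Shift A) (m n : ℤ) :
    IsOpen (Subtype.val ⁻¹' ray w n : Set (ray y m)) := by
  rcases eq_empty_or_nonempty (Subtype.val ⁻¹' ray w n : Set (ray y m)) with h | ⟨z, hz⟩
  · rw [h]
    exact isOpen_empty
  have hcyl : (Subtype.val ⁻¹' ray w n : Set (ray y m)) =
      ⋂ i ∈ Finset.Ioc m n, {a : ray y m | a.1 i = z.1 i} := by
    ext a
    simp only [mem_iInter, Finset.mem_Ioc, mem_ofPred_eq]
    refine ⟨fun ha i hi => (ha i hi.2).trans (hz i hi.2).symm, fun ha i hi => ?_⟩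
    rcases le_or_gt i m with him | him
    · exact (a.2 i him).trans ((z.2 i him).symm.trans (hz i hi))
    · exact (ha i ⟨him, hi⟩).trans (hz i hi)
  rw [hcyl]
  exact isOpen_biInter_finset fun i _ => (isOpen_discrete {z.1 i}).preimage
    ((Shift.continuous_apply i).comp continuous_subtype_val)

theorem isCompact_unstableRay {x : Shift A} (y : Unstable x) (m : ℤ) :
    IsCompact (unstableRay x y.pt m) := by
  have : CompactSpace (ray y.pt m) :=
    isCompact_iff_compactSpace.1 (isClosed_ray y.pt m).isCompact
  choose g hg using fun z : ray y.pt m => ray_subset_range_pt y m z.2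
  have hrange : range g = unstableRay x y.pt m := by
    ext w
    constructor
    · rintro ⟨z, rfl⟩
      change (g z).pt ∈ ray y.pt m
      rw [hg]
      exact z.2
    · exact fun hw => ⟨⟨w.pt, hw⟩, Unstable.pt_injective (hg _)⟩
  rw [← hrange]
  refine isCompact_range (continuous_generateFrom_iff.2 ?_)
  rintro _ ⟨w, n, rfl⟩
  convert isOpen_preimage_val_ray y.pt w.pt m n using 1
  ext z
  change (g z).pt ∈ ray w.pt n ↔ z.1 ∈ ray w.pt n
  rw [hg]

theorem isCompact_of_isBeam {x : Shift A} {T : Set (Unstable x)}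
    (hT : IsBeam (Unstable.pt '' T)) : IsCompact T := by
  obtain ⟨m, s, hs, hU⟩ := hT
  rw [← preimage_image_eq T Unstable.pt_injective, hU, preimage_biUnion_ray]
  refine hs.isCompact_biUnion fun y hy => ?_
  obtain ⟨z, -, rfl⟩ : y ∈ Unstable.pt '' T := hU ▸ mem_biUnion hy (self_mem_ray y m)
  exact isCompact_unstableRay z m

theorem isOpen_of_isBeam {x : Shift A} {T : Set (Unstable x)}
    (hT : IsBeam (Unstable.pt '' T)) : IsOpen T := by
  rw [← preimage_image_eq T Unstable.pt_injective]
  exact hT.isOpen_preimage x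

theorem countable_unstableRays (x : Shift A) :
    {U | ∃ (y : Unstable x) (m : ℤ), U = unstableRay x y.pt m}.Countable := by
  have hcount (m n : ℤ) : ((fun R : Set (Shift A) => Unstable.pt (x := x) ⁻¹' R) ''
      ((fun y => ray y (max m n)) '' ray x n)).Countable :=
    ((isBeamAt_iff.1 ((isBeamAt_ray x n).mono (le_max_right m n))).2.image _).countable
  refine (countable_iUnion fun m => countable_iUnion fun n => hcount m n).mono ?_
  rintro _ ⟨y, m, rfl⟩
  obtain ⟨n, hn⟩ := mem_iUnion.1 y.mem
  refine mem_iUnion.2 ⟨m, mem_iUnion.2 ⟨min m n, ray y.pt m, ⟨y.pt, ?_, ?_⟩, rfl⟩⟩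
  · exact fun i hi => hn i (hi.trans (min_le_right _ _))
  · simp

instance (x : Shift A) : SecondCountableTopology (Unstable x) :=
  ⟨⟨_, countable_unstableRays x, rfl⟩⟩

theorem continuous_of_forall_pt_eq {x x' : Shift A} (φ : Aut A) {f : Unstable x → Unstable x'}
    (hf : ∀ y, (f y).pt = φ y.pt) : Continuous f := by
  refine continuous_generateFrom_iff.2 ?_
  rintro _ ⟨w, n, rfl⟩
  convert ((isBeam_ray w.pt n).image φ.inv).isOpen_preimage x using 1
  ext y
  change (f y).pt ∈ ray w.pt n ↔ y.pt ∈ φ.inv '' ray w.pt n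
  rw [hf]
  constructor
  · exact fun hy => ⟨φ y.pt, hy, φ.inv_apply_self _⟩
  · rintro ⟨a, ha, hay⟩
    rwa [← hay, Aut.apply_inv_self]

/-- The homeomorphism `W^u(x) → W^u(φ(x))` induced by an automorphism `φ`. -/
def Aut.unstableHomeo (φ : Aut A) (x : Shift A) : Unstable x ≃ₜ Unstable (φ x) where
  toFun := φ.unstableMap x
  invFun z := ⟨φ.inv z.pt, by
    have h : φ.inv z.pt ∈ ⋃ n : ℤ, ray (φ.inv (φ x)) n := (φ.inv.unstableMap (φ x) z).mem
    rwa [Aut.inv_apply_self] at h⟩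
  left_inv y := Unstable.pt_injective (φ.inv_apply_self y.pt)
  right_inv z := Unstable.pt_injective (φ.apply_inv_self z.pt)
  continuous_toFun := continuous_of_forall_pt_eq φ fun _ => rfl
  continuous_invFun := continuous_of_forall_pt_eq φ.inv fun _ => rfl

theorem Aut.measurableEmbedding_unstableMap (φ : Aut A) (x : Shift A) :
    MeasurableEmbedding (φ.unstableMap x) :=
  (φ.unstableHomeo x).isOpenEmbedding.measurableEmbedding

/-! ### The ring of beams in an unstable set -/

theorem IsBeamAt.sdiff {m : ℤ} {U V : Set (Shift A)} (hU : IsBeamAt m U) (hV : IsBeamAt m V) :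
    IsBeamAt m (U \ V) := by
  rw [isBeamAt_iff] at hU hV ⊢
  refine ⟨fun y hy z hz => ⟨hU.1 y hy.1 hz, fun hzV => hy.2 ?_⟩,
    hU.2.subset (image_mono sdiff_subset)⟩
  refine hV.1 z hzV ?_
  rw [ray_eq_of_mem hz]
  exact self_mem_ray y m

theorem IsBeam.sdiff {U V : Set (Shift A)} (hU : IsBeam U) (hV : IsBeam V) : IsBeam (U \ V) := by
  obtain ⟨m, hm⟩ := hU
  obtain ⟨n, hn⟩ := hV
  exact ⟨max m n, (hm.mono (le_max_left _ _)).sdiff (hn.mono (le_max_right _ _))⟩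

/-- The beams contained in `W^u(x)`. -/
def unstableBeams (x : Shift A) : Set (Set (Unstable x)) := {T | IsBeam (Unstable.pt '' T)}

theorem isSetRing_unstableBeams (x : Shift A) : IsSetRing (unstableBeams x) where
  empty_mem := by
    change IsBeam _
    rw [image_empty]
    exact ⟨0, isBeamAt_empty 0⟩
  union_mem s t hs ht := by
    change IsBeam _
    rw [image_union]
    exact hs.union ht
  sdiff_mem s t hs ht := by
    change IsBeam _
    rw [image_sdiff Unstable.pt_injective]
    exact hs.sdiff ht

theorem unstableRay_mem_unstableBeams {x : Shift A} (y : Unstable x) (m : ℤ) :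
    unstableRay x y.pt m ∈ unstableBeams x := by
  change IsBeam _
  rw [image_unstableRay]
  exact isBeam_ray _ _

theorem borel_eq_generateFrom_unstableBeams (x : Shift A) :
    (inferInstance : MeasurableSpace (Unstable x)) =
      MeasurableSpace.generateFrom (unstableBeams x) := by
  refine le_antisymm ?_ (MeasurableSpace.generateFrom_le fun T hT =>
    (isOpen_of_isBeam hT).measurableSet)
  refine (borel_eq_generateFrom_of_subbasis (α := Unstable x) rfl).le.trans
    (MeasurableSpace.generateFrom_mono ?_)
  rintro _ ⟨y, m, rfl⟩
  exact unstableRay_mem_unstableBeams y m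

theorem iUnion_unstableRay_base (x : Shift A) :
    ⋃ n : ℕ, unstableRay x (Unstable.base x).pt (-n) = univ := by
  refine eq_univ_of_forall fun y => ?_
  obtain ⟨n, hn⟩ := mem_iUnion.1 y.mem
  exact mem_iUnion.2 ⟨n.natAbs, fun i hi => hn i (by omega)⟩

theorem image_pt_image_unstableMap (φ : Aut A) {x : Shift A} (T : Set (Unstable x)) :
    Unstable.pt '' (φ.unstableMap x '' T) = φ '' (Unstable.pt '' T) := by
  rw [image_image, image_image]
  rfl

theorem image_unstableMap_mem_unstableBeams (φ : Aut A) {x : Shift A} {T : Set (Unstable x)}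
    (hT : T ∈ unstableBeams x) : φ.unstableMap x '' T ∈ unstableBeams (φ x) := by
  change IsBeam _
  rw [image_pt_image_unstableMap]
  exact IsBeam.image φ hT

/-! ### Measures on unstable sets -/

section

variable [Nonempty (Fin k)]

open Classical in
/-- The content on the beams in `W^u(x)` given by the state of a Perron vector. -/
noncomputable def unstableContent (hA : Irred A) {v : Fin k → ℝ} (hv : IsPerronVec A v)
    (x : Shift A) : AddContent ENNReal (unstableBeams x) :=
  (isSetRing_unstableBeams x).addContent_of_union
    (fun T => if h : IsBeam (Unstable.pt '' T) then
      ENNReal.ofReal (perronState hA v (beamClass ⟨_, h⟩)) else 0)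
    (by
      have hempty : IsBeam (Unstable.pt (x := x) '' ∅) := (isSetRing_unstableBeams x).empty_mem
      rw [dif_pos hempty, beamClass_of_eq_empty (image_empty _), map_zero, ENNReal.ofReal_zero])
    (fun {s t} hs ht hd => by
      have hst : IsBeam (Unstable.pt '' (s ∪ t)) :=
        (isSetRing_unstableBeams x).union_mem hs ht
      replace hs : IsBeam (Unstable.pt '' s) := hs
      replace ht : IsBeam (Unstable.pt '' t) := ht
      rw [dif_pos hs, dif_pos ht, dif_pos hst,
        ← ENNReal.ofReal_add (hv.perronState_nonneg hA _) (hv.perronState_nonneg hA _), ← map_add,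
        beamClass_union (U := ⟨_, hs⟩) (V := ⟨_, ht⟩) (W := ⟨_, hst⟩)
          ((disjoint_image_iff Unstable.pt_injective).2 hd) (image_union _ _ _)])

theorem unstableContent_apply (hA : Irred A) {v : Fin k → ℝ} (hv : IsPerronVec A v)
    {x : Shift A} {T : Set (Unstable x)} (hT : T ∈ unstableBeams x) :
    unstableContent hA hv x T = ENNReal.ofReal (perronState hA v (beamClass ⟨_, hT⟩)) :=
  dif_pos hT

-- Beams are compact and open, so a countable cover of one by others has a finite subcover.
theorem unstableContent_isSigmaSubadditive (hA : Irred A) {v : Fin k → ℝ}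
    (hv : IsPerronVec A v) (x : Shift A) : (unstableContent hA hv x).IsSigmaSubadditive := by
  intro f hf hU
  obtain ⟨t, ht⟩ := (isCompact_of_isBeam hU).elim_finite_subcover f
    (fun i => isOpen_of_isBeam (hf i)) Subset.rfl
  have hfinite : ⋃ i, f i = ⋃ i ∈ t, f i :=
    Subset.antisymm ht (iUnion₂_subset fun i _ => subset_iUnion f i)
  rw [hfinite]
  exact (addContent_biUnion_le (isSetRing_unstableBeams x) fun i _ => hf i).trans
    (ENNReal.sum_le_tsum t)

/-- The measure on `W^u(x)` given by a Perron vector. -/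
noncomputable def unstableMeasure (hA : Irred A) {v : Fin k → ℝ} (hv : IsPerronVec A v)
    (x : Shift A) : Measure (Unstable x) :=
  (unstableContent hA hv x).measure (isSetRing_unstableBeams x).isSetSemiring
    (borel_eq_generateFrom_unstableBeams x).le (unstableContent_isSigmaSubadditive hA hv x)

theorem unstableMeasure_unstableRay (hA : Irred A) {v : Fin k → ℝ} (hv : IsPerronVec A v)
    (x : Shift A) (y : Unstable x) (m : ℤ) :
    unstableMeasure hA hv x (unstableRay x y.pt m) =
      ENNReal.ofReal (perron A ^ (-m) * v (y.pt m).tgt) := by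
  have hT := unstableRay_mem_unstableBeams y m
  rw [unstableMeasure, AddContent.measure_eq _ _ (borel_eq_generateFrom_unstableBeams x) _ hT,
    unstableContent_apply hA hv hT, ← hv.perronState_rayBeam hA]
  congr 3
  exact Subtype.ext (image_unstableRay y m)

theorem Irred.exists_isUnstableMeasureFamily (hA : Irred A) :
    ∃ μ : ∀ x : Shift A, Measure (Unstable x), IsUnstableMeasureFamily μ :=
  let ⟨v, hv⟩ := hA.exists_isPerronVec
  ⟨unstableMeasure hA hv, v, hv.pos, hv.mulVec, unstableMeasure_unstableRay hA hv⟩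

theorem IsPerronVec.measure_preimage_beam {v : Fin k → ℝ} (hv : IsPerronVec A v) (hA : Irred A)
    {x : Shift A} {μ : Measure (Unstable x)}
    (hμ : ∀ (y : Unstable x) (m : ℤ),
      μ (unstableRay x y.pt m) = ENNReal.ofReal (perron A ^ (-m) * v (y.pt m).tgt))
    (U : Beam A) (hU : U.1 ⊆ range (Unstable.pt (x := x))) :
    μ (Unstable.pt ⁻¹' U.1) = ENNReal.ofReal (perronState hA v (beamClass U)) := by
  obtain ⟨U, m, hm⟩ := U
  refine IsBeamAt.induction (p := fun U => ∀ h : IsBeam U, U ⊆ range (Unstable.pt (x := x)) →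
    μ (Unstable.pt ⁻¹' U) = ENNReal.ofReal (perronState hA v (beamClass ⟨U, h⟩)))
    (fun h _ => ?_) (fun U y hU hd ih hUy hsub => ?_) hm ⟨m, hm⟩ hU
  · rw [beamClass_of_eq_empty rfl, map_zero, preimage_empty, measure_empty, ENNReal.ofReal_zero]
  · have hbeam : IsBeam U := ⟨m, hU⟩
    obtain ⟨z, rfl⟩ := hsub (Or.inr (self_mem_ray y m))
    rw [preimage_union, measure_union (hd.preimage _)
      ((isBeam_ray z.pt m).isOpen_preimage x).measurableSet,
      ih hbeam (subset_union_left.trans hsub),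
      beamClass_union (U := ⟨U, hbeam⟩) (V := rayBeam z.pt m) (W := ⟨_, hUy⟩) hd rfl, map_add,
      ENNReal.ofReal_add (hv.perronState_nonneg hA _) (hv.perronState_nonneg hA _),
      hv.perronState_rayBeam hA]
    congr 1
    exact hμ z m

theorem IsPerronVec.measure_eq_perronState {v : Fin k → ℝ} (hv : IsPerronVec A v) (hA : Irred A)
    {x : Shift A} {μ : Measure (Unstable x)}
    (hμ : ∀ (y : Unstable x) (m : ℤ),
      μ (unstableRay x y.pt m) = ENNReal.ofReal (perron A ^ (-m) * v (y.pt m).tgt))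
    {T : Set (Unstable x)} (hT : T ∈ unstableBeams x) :
    μ T = ENNReal.ofReal (perronState hA v (beamClass ⟨_, hT⟩)) := by
  rw [← hv.measure_preimage_beam hA hμ ⟨_, hT⟩ (image_subset_range _ _),
    preimage_image_eq T Unstable.pt_injective]

theorem IsPerronVec.measure_image_eq_scale_mul {v : Fin k → ℝ} (hv : IsPerronVec A v)
    (hA : Irred A) (φ : Aut A) {μ : ∀ x : Shift A, Measure (Unstable x)}
    (hμ : ∀ (x : Shift A) (y : Unstable x) (m : ℤ),
      μ x (unstableRay x y.pt m) = ENNReal.ofReal (perron A ^ (-m) * v (y.pt m).tgt))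
    {x : Shift A} {T : Set (Unstable x)} (hT : T ∈ unstableBeams x) :
    μ (φ x) (φ.unstableMap x '' T) = ENNReal.ofReal (scale hA φ) * μ x T := by
  rw [hv.measure_eq_perronState hA (hμ (φ x)) (image_unstableMap_mem_unstableBeams φ hT),
    hv.measure_eq_perronState hA (hμ x) hT, ← ENNReal.ofReal_mul (scale_pos hA φ).le,
    ← perronState_dimMap hA φ hv.mulVec, Aut.dimMap_beamClass]
  congr 3
  exact Subtype.ext (image_pt_image_unstableMap φ T)

theorem scalesMeasures_scale (hA : Irred A) (φ : Aut A) : ScalesMeasures φ (scale hA φ) := by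
  rintro μ ⟨v, hpos, hmulVec, hμ⟩ x S -
  have hv : IsPerronVec A v := ⟨hpos, hmulVec⟩
  have hemb := φ.measurableEmbedding_unstableMap x
  have heq : ENNReal.ofReal (scale hA φ) • μ x = (μ (φ x)).comap (φ.unstableMap x) := by
    refine Measure.ext_of_generateFrom_of_iUnion (unstableBeams x) _
      (borel_eq_generateFrom_unstableBeams x) (isSetRing_unstableBeams x).isSetSemiring.isPiSystem
      (iUnion_unstableRay_base x) (fun n => unstableRay_mem_unstableBeams _ _) (fun n => ?_)
      (fun T hT => ?_)
    · rw [Measure.smul_apply, smul_eq_mul, hμ]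
      exact ENNReal.mul_ne_top ENNReal.ofReal_ne_top ENNReal.ofReal_ne_top
    · rw [hemb.comap_apply, hv.measure_image_eq_scale_mul hA φ hμ hT, Measure.smul_apply,
        smul_eq_mul]
  rw [← hemb.comap_apply, ← heq, Measure.smul_apply, smul_eq_mul]

theorem scalesMeasures_iff (hA : Irred A) (φ : Aut A) (c : ℝ) :
    ScalesMeasures φ c ↔ c = scale hA φ := by
  refine ⟨fun hc => ?_, fun hc => hc ▸ scalesMeasures_scale hA φ⟩
  obtain ⟨x, -⟩ := hA.exists_point 0 (Classical.arbitrary _)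
  obtain ⟨μ, hμ⟩ := hA.exists_isUnstableMeasureFamily
  let R := unstableRay x (Unstable.base x).pt 0
  have hR : MeasurableSet R := (isOpen_unstableRay _ _ _).measurableSet
  have heq : ENNReal.ofReal c * μ x R = ENNReal.ofReal (scale hA φ) * μ x R :=
    (hc μ hμ x R hR).symm.trans (scalesMeasures_scale hA φ μ hμ x R hR)
  obtain ⟨v, hpos, -, hv⟩ := hμ
  have hR0 : μ x R ≠ 0 := by
    rw [hv x, Ne, ENNReal.ofReal_eq_zero, not_le]
    exact mul_pos (zpow_pos hA.perron_pos _) (hpos _)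
  have hRtop : μ x R ≠ ⊤ := hv x (Unstable.base x) 0 ▸ ENNReal.ofReal_ne_top
  have hscale := (ENNReal.mul_left_inj hR0 hRtop).1 heq
  have hc0 : 0 < c := ENNReal.ofReal_pos.1 (hscale ▸ ENNReal.ofReal_pos.2 (scale_pos hA φ))
  exact (ENNReal.ofReal_eq_ofReal_iff hc0.le (scale_pos hA φ).le).1 hscale

theorem scalesState_iff (hA : Irred A) (φ : Aut A) (c : ℝ) :
    ScalesState φ c ↔ c = scale hA φ := by
  constructor
  · intro hc
    obtain ⟨μ, v, hpos, hmulVec, hμ⟩ := hA.exists_isUnstableMeasureFamily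
    have hv : IsPerronVec A v := ⟨hpos, hmulVec⟩
    exact hv.eq_scale hA (hc μ _ ⟨v, hpos, hmulVec, hμ⟩ (hv.isState_perronState hA hμ))
  · rintro rfl μ τ ⟨v, hpos, hmulVec, hμ⟩ hτ
    have hv : IsPerronVec A v := ⟨hpos, hmulVec⟩
    rw [hτ.unique hA (hv.isState_perronState hA hμ)]
    exact perronState_dimMap hA φ hmulVec

end

/-! ### Entropy -/

open Dynamics

-- Reversing orbit segments of length `n` turns dynamical covers for `e` into ones for `e⁻¹`.
theorem coverMincard_symm_le {X : Type*} (e : X ≃ X) (U : SetRel X X) (n : ℕ) :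
    coverMincard e.symm univ U n ≤ coverMincard e univ U n := by
  classical
  refine le_iInf₂ fun s hs => ?_
  have hiter (j) (hj : j < n) (z : X) : e.symm^[j] (e^[n - 1] z) = e^[n - 1 - j] z := by
    obtain ⟨d, hd⟩ := Nat.exists_eq_add_of_le (show j ≤ n - 1 by omega)
    rw [hd, Function.iterate_add_apply, (e.leftInverse_symm.iterate j).eq, Nat.add_sub_cancel_left]
  have hcover : IsDynCoverOf e.symm univ U n (s.image e^[n - 1] : Finset X) := by
    intro y _
    obtain ⟨z, hz, hyz⟩ := hs (mem_univ (e.symm^[n - 1] y))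
    refine ⟨e^[n - 1] z, by simpa using ⟨z, hz, rfl⟩, ?_⟩
    change (_, _) ∈ dynEntourage _ _ _ at hyz
    rw [mem_dynEntourage] at hyz ⊢
    intro j hj
    have hclose := hyz (n - 1 - j) (by omega)
    rwa [← hiter j hj, ← hiter j hj, (e.rightInverse_symm.iterate (n - 1)).eq] at hclose
  exact hcover.coverMincard_le_card.trans (by exact_mod_cast Finset.card_image_le)

theorem coverEntropy_symm_le {X : Type*} [UniformSpace X] (e : X ≃ X) :
    coverEntropy e.symm univ ≤ coverEntropy e univ :=
  iSup₂_mono fun U _ => ExpGrowth.expGrowthSup_monotone fun n => by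
    exact ENat.toENNReal_le.2 (coverMincard_symm_le e U n)

theorem htop_inv_le (φ : Aut A) : htop φ.inv ≤ htop φ :=
  coverEntropy_symm_le φ.1.toEquiv

theorem nonempty_fin_of_htop_pos (h : 0 < htop (shift A)) : Nonempty (Fin k) := by
  by_contra hk
  have : IsEmpty (Shift A) := ⟨fun x => hk ⟨(x 0).src⟩⟩
  rw [htop, univ_eq_empty_iff.2 this, coverEntropy_empty] at h
  exact not_lt_bot h

/-- The entourage of the pairs of points that agree on `[-w, w]`. -/
def windowEntourage (A : Matrix (Fin k) (Fin k) ℕ) (w : ℕ) : SetRel (Shift A) (Shift A) :=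
  {p | ∀ j : ℤ, -w ≤ j → j ≤ w → p.1 j = p.2 j}

theorem windowEntourage_mem_uniformity (w : ℕ) : windowEntourage A w ∈ uniformity (Shift A) := by
  have hcoord (j : ℤ) : {p : Shift A × Shift A | p.1 j = p.2 j} ∈ uniformity (Shift A) := by
    have huniform : UniformContinuous (fun x : Shift A => x j) :=
      (Pi.uniformContinuous_proj _ j).comp uniformContinuous_subtype_val
    have hdiag : (SetRel.id : SetRel (Edge A) (Edge A)) ∈ uniformity (Edge A) := by
      rw [DiscreteUniformity.eq_principal_setRelId]
      exact mem_principal_self _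
    exact huniform hdiag
  have hinter : windowEntourage A w =
      ⋂ j ∈ Finset.Icc (-(w : ℤ)) w, {p : Shift A × Shift A | p.1 j = p.2 j} := by
    ext p
    simp [windowEntourage]
  rw [hinter]
  exact (biInter_finset_mem _).2 fun j _ => hcoord j

-- One application of `φ` costs `r` coordinates of agreement, and the window restores them.
theorem HasRange.agree_iterate {φ : Shift A → Shift A} {r : ℕ} (h : HasRange φ r)
    {y z : Shift A} (h0 : ∀ i ≤ 0, y i = z i) {n : ℕ}
    (hyz : ∀ j ≤ n, (φ^[j] y, φ^[j] z) ∈ windowEntourage A r) :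
    ∀ i ≤ (r : ℤ), φ^[n] y i = φ^[n] z i := by
  have hextend {y z : Shift A} (hneg : ∀ i ≤ 0, y i = z i)
      (hwin : (y, z) ∈ windowEntourage A r) (i : ℤ) (hi : i ≤ r) : y i = z i := by
    rcases le_or_gt i 0 with hi0 | hi0
    · exact hneg i hi0
    · exact hwin i (by omega) hi
  induction n with
  | zero => exact hextend h0 (hyz 0 le_rfl)
  | succ n ih =>
    refine hextend (fun i hi => ?_) (hyz (n + 1) le_rfl)
    rw [Function.iterate_succ_apply', Function.iterate_succ_apply']
    exact h.agree (ih fun j hj => hyz j (by omega)) i (by omega)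

theorem exists_image_iterate_subset_biUnion_ray {φ : Shift A → Shift A} {r : ℕ}
    (hr : HasRange φ r) (x : Shift A) {n : ℕ} {s : Finset (Shift A)}
    (hs : IsDynCoverOf φ univ (windowEntourage A r) (n + 1) s) :
    ∃ t : Finset (Shift A), t.card ≤ s.card ∧ φ^[n] '' ray x 0 ⊆ ⋃ y ∈ t, ray y r := by
  classical
  let near (y z : Shift A) : Prop := ∀ j ≤ n, (φ^[j] y, φ^[j] z) ∈ windowEntourage A r
  choose! g hgray hgnear using fun z (hz : ∃ y ∈ ray x 0, near y z) => hz
  refine ⟨s.image fun z => φ^[n] (g z), Finset.card_image_le, ?_⟩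
  rintro _ ⟨y, hy, rfl⟩
  obtain ⟨z, hz, hyz⟩ := hs (mem_univ y)
  change (_, _) ∈ dynEntourage _ _ _ at hyz
  rw [mem_dynEntourage] at hyz
  have hnear : near y z := fun j hj => hyz j (by omega)
  have hex : ∃ y ∈ ray x 0, near y z := ⟨y, hy, hnear⟩
  refine mem_biUnion (Finset.mem_image_of_mem (fun z => φ^[n] (g z)) hz) ?_
  refine hr.agree_iterate (fun i hi => ?_) fun j hj i hi hi' => ?_
  · rw [hy i hi, hgray z hex i hi]
  · exact (hnear j hj i hi hi').trans (hgnear z hex j hj i hi hi').symm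

theorem iterate_mapBeam (φ : Aut A) (U : Beam A) (n : ℕ) :
    (φ.mapBeam^[n] U).1 = φ^[n] '' U.1 := by
  induction n with
  | zero => simp
  | succ n ih =>
    rw [Function.iterate_succ_apply', Function.iterate_succ', image_comp, ← ih]
    rfl

variable [Nonempty (Fin k)]

theorem perronState_iterate_mapBeam (hA : Irred A) (φ : Aut A) {v : Fin k → ℝ}
    (hv : A.map (Nat.cast : ℕ → ℝ) *ᵥ v = perron A • v) (U : Beam A) (n : ℕ) :
    perronState hA v (beamClass (φ.mapBeam^[n] U)) =
      scale hA φ ^ n * perronState hA v (beamClass U) := by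
  induction n with
  | zero => rw [pow_zero, one_mul, Function.iterate_zero_apply]
  | succ n ih =>
    rw [Function.iterate_succ_apply', ← Aut.dimMap_beamClass, perronState_dimMap hA φ hv, ih,
      pow_succ', mul_assoc]

theorem IsPerronVec.perronState_mono {v : Fin k → ℝ} (hv : IsPerronVec A v) (hA : Irred A)
    {U V : Beam A} (h : U.1 ⊆ V.1) :
    perronState hA v (beamClass U) ≤ perronState hA v (beamClass V) := by
  rw [beamClass_union (U := U) (V := ⟨V.1 \ U.1, V.2.sdiff U.2⟩) (W := V) disjoint_sdiff_right
    (union_sdiff_cancel h).symm, map_add]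
  exact le_add_of_nonneg_right (hv.perronState_nonneg hA _)

theorem IsPerronVec.perronState_le_card_mul {v : Fin k → ℝ} (hv : IsPerronVec A v)
    (hA : Irred A) {w : ℤ} {K : ℝ} (hK : ∀ J, perron A ^ (-w) * v J ≤ K)
    (t : Finset (Shift A)) (U : Beam A) (hU : U.1 ⊆ ⋃ y ∈ t, ray y w) :
    perronState hA v (beamClass U) ≤ t.card * K := by
  classical
  induction t using Finset.induction_on generalizing U with
  | empty =>
    rw [beamClass_of_eq_empty (subset_empty_iff.1 (by simpa using hU))]
    simp
  | insert y t hy ih =>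
    let V : Beam A := ⟨U.1 \ ray y w, U.2.sdiff (isBeam_ray y w)⟩
    let W : Beam A := ⟨U.1 \ V.1, U.2.sdiff V.2⟩
    have hV : perronState hA v (beamClass V) ≤ t.card * K := ih V <| by
      rintro z ⟨hz, hzy⟩
      have hzt := hU hz
      rw [Finset.set_biUnion_insert] at hzt
      exact hzt.resolve_left hzy
    have hW : perronState hA v (beamClass W) ≤ K := by
      refine (hv.perronState_mono hA (V := rayBeam y w) fun z hz => ?_).trans ?_
      · by_contra hzy
        exact hz.2 ⟨hz.1, hzy⟩
      · rw [hv.perronState_rayBeam hA]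
        exact hK _
    rw [beamClass_union (U := V) (V := W) (W := U) disjoint_sdiff_right
      (union_sdiff_cancel sdiff_subset).symm, map_add, Finset.card_insert_of_notMem hy]
    push_cast
    linarith

theorem exists_pos_scale_pow_le_card (hA : Irred A) (φ : Aut A) {r : ℕ} (hr : HasRange φ r) :
    ∃ b : ℝ, 0 < b ∧ ∀ (n : ℕ) (s : Finset (Shift A)),
      IsDynCoverOf φ univ (windowEntourage A r) (n + 1) s → b * scale hA φ ^ (n + 1) ≤ s.card := by
  obtain ⟨v, hv⟩ := hA.exists_isPerronVec
  obtain ⟨x, -⟩ := hA.exists_point 0 (Classical.arbitrary _)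
  obtain ⟨J, hJ⟩ := Finite.exists_max fun J => perron A ^ (-(r : ℤ)) * v J
  set K := perron A ^ (-(r : ℤ)) * v J
  have hK : 0 < K := mul_pos (zpow_pos hA.perron_pos _) (hv.pos _)
  set a := perronState hA v (beamClass (rayBeam x 0))
  have ha : 0 < a := hv.perronState_rayBeam_pos hA x 0
  have hscale := scale_pos hA φ
  refine ⟨a / (K * scale hA φ), by positivity, fun n s hs => ?_⟩
  obtain ⟨t, hts, ht⟩ := exists_image_iterate_subset_biUnion_ray hr x hs
  have hle : scale hA φ ^ n * a ≤ s.card * K := calc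
    scale hA φ ^ n * a = perronState hA v (beamClass (φ.mapBeam^[n] (rayBeam x 0))) :=
      (perronState_iterate_mapBeam hA φ hv.mulVec _ n).symm
    _ ≤ t.card * K := hv.perronState_le_card_mul hA hJ t _ (by rwa [iterate_mapBeam])
    _ ≤ s.card * K := by gcongr
  calc a / (K * scale hA φ) * scale hA φ ^ (n + 1) = scale hA φ ^ n * a / K := by
        rw [pow_succ]
        field_simp
    _ ≤ s.card := (div_le_iff₀ hK).2 hle

theorem log_scale_le_htop (hA : Irred A) (φ : Aut A) :
    ((Real.log (scale hA φ) : ℝ) : EReal) ≤ htop φ := by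
  obtain ⟨r, hr, -⟩ := φ.exists_range
  obtain ⟨b, hb, hcard⟩ := exists_pos_scale_pow_le_card hA φ hr
  refine le_trans ?_ (coverEntropyEntourage_le_coverEntropy φ univ
    (windowEntourage_mem_uniformity r))
  rw [← ENNReal.log_ofReal_of_pos (scale_pos hA φ), ← ExpGrowth.expGrowthSup_pow]
  refine ExpGrowth.expGrowthSup_of_eventually_ge (ENNReal.ofReal_pos.2 hb).ne' ?_
  filter_upwards [eventually_ge_atTop 1] with n hn
  obtain ⟨n, rfl⟩ := Nat.exists_eq_add_of_le' hn
  rcases eq_or_ne (coverMincard φ univ (windowEntourage A r) (n + 1)) ⊤ with htop | htop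
  · rw [htop]
    exact le_top
  · obtain ⟨s, hs, hmin⟩ := (coverMincard_finite_iff _ _ _ _).1 htop.lt_top
    rw [← hmin, ← ENNReal.ofReal_pow (scale_pos hA φ).le, ← ENNReal.ofReal_mul hb.le,
      ENat.toENNReal_coe, ← ENNReal.ofReal_natCast]
    exact ENNReal.ofReal_le_ofReal (hcard n s hs)

theorem abs_log_scale_le_htop (hA : Irred A) (φ : Aut A) :
    ((|Real.log (scale hA φ)| : ℝ) : EReal) ≤ htop φ := by
  rcases abs_choice (Real.log (scale hA φ)) with h | h <;> rw [h]
  · exact log_scale_le_htop hA φ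
  · rw [← Real.log_inv, ← scale_inv]
    exact (log_scale_le_htop hA φ.inv).trans (htop_inv_le φ)

end SFT

theorem theorem3p1_general {k : ℕ} [Nonempty (Fin k)] (A : Matrix (Fin k) (Fin k) ℕ)
    (hA : SFT.Irred A) (φ : SFT.Aut A) :
    (∃ μ : ∀ x : SFT.Shift A, Measure (SFT.Unstable x), SFT.IsUnstableMeasureFamily μ) ∧
    (∀ μ : ∀ x : SFT.Shift A, Measure (SFT.Unstable x), SFT.IsUnstableMeasureFamily μ →
      ∃! τ : SFT.DimGroup A →+ ℝ, SFT.IsState μ τ) ∧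
    (∃! S : SFT.MatAut A, SFT.IsDimRep hA φ S) ∧
    (∃ v : ℂ ⊗[ℤ] SFT.matGroup A, v ≠ 0 ∧
      SFT.complexify (SFT.delta A) v = (SFT.perron A : ℂ) • v) ∧
    ∃ lam : ℝ, 0 < lam ∧
      (∀ c : ℝ, SFT.ScalesMeasures φ c ↔ c = lam) ∧
      (∀ c : ℝ, SFT.ScalesState φ c ↔ c = lam) ∧
      (∀ c : ℂ, SFT.IsPerronEigenvalue hA φ c ↔ c = (lam : ℂ)) ∧
      ((Real.log lam : ℝ) : EReal) ≤ SFT.htop φ ∧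
      ((|Real.log lam| : ℝ) : EReal) ≤ SFT.htop φ :=
  ⟨hA.exists_isUnstableMeasureFamily,
    fun _ hμ => hμ.existsUnique_isState hA,
    ⟨SFT.dimRep hA φ, SFT.isDimRep_dimRep hA φ, fun _ hS => hS.unique (SFT.isDimRep_dimRep hA φ)⟩,
    hA.exists_complexify_delta_eq,
    SFT.scale hA φ, SFT.scale_pos hA φ, SFT.scalesMeasures_iff hA φ, SFT.scalesState_iff hA φ,
    SFT.isPerronEigenvalue_iff hA φ, SFT.log_scale_le_htop hA φ, SFT.abs_log_scale_le_htop hA φ⟩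

/-- Let `A` be an irreducible matrix whose edge shift has positive entropy, and let `φ` be an
automorphism of the edge shift. The canonical measures on unstable sets, the states they define
on the dimension group, the automorphism `S_φ` and a Perron eigenvector of `δ_A` exist. There is
a number `lam > 0` that is the one factor by which `φ` scales these measures, the one factor by
which it scales the states, and the eigenvalue of `S_φ` on the Perron eigenvectors of `δ_A`;
and `log lam ≤ |log lam| ≤ h_top(φ)`. -/
theorem theorem3p1 {k : ℕ} (A : Matrix (Fin k) (Fin k) ℕ) (hA : SFT.Irred A)
    (hpos : 0 < SFT.htop (SFT.shift A)) (φ : SFT.Aut A) :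
    (∃ μ : ∀ x : SFT.Shift A, Measure (SFT.Unstable x), SFT.IsUnstableMeasureFamily μ) ∧
    (∀ μ : ∀ x : SFT.Shift A, Measure (SFT.Unstable x), SFT.IsUnstableMeasureFamily μ →
      ∃! τ : SFT.DimGroup A →+ ℝ, SFT.IsState μ τ) ∧
    (∃! S : SFT.MatAut A, SFT.IsDimRep hA φ S) ∧
    (∃ v : ℂ ⊗[ℤ] SFT.matGroup A, v ≠ 0 ∧
      SFT.complexify (SFT.delta A) v = (SFT.perron A : ℂ) • v) ∧
    ∃ lam : ℝ, 0 < lam ∧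
      (∀ c : ℝ, SFT.ScalesMeasures φ c ↔ c = lam) ∧
      (∀ c : ℝ, SFT.ScalesState φ c ↔ c = lam) ∧
      (∀ c : ℂ, SFT.IsPerronEigenvalue hA φ c ↔ c = (lam : ℂ)) ∧
      ((Real.log lam : ℝ) : EReal) ≤ SFT.htop φ ∧
      ((|Real.log lam| : ℝ) : EReal) ≤ SFT.htop φ :=
  have := SFT.nonempty_fin_of_htop_pos hpos
  theorem3p1_general A hA φ
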